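/- **Theorem.** The model-checking problem for pr-rf-RAL' under finite semantics is decidable: there is an algorithm which, given a finite resource-bounded model $M$, a state $q$ of $M$ and a pr-rf-RAL' formula $\varphi$ over $M$, decides whether $M,q\models\varphi$. This holds for each of the two conventions (lax and exact) on shares described below. *Models.* A resource-bounded model $M$ has finite non-empty sets $Agt$ of agents, $Q$ of states, $Act$ of actions and $Res$ of resources, a finite set $\Pi$ of propositions, a valuation $\pi:Q\to\wp(\Pi)$, a function $d:Agt\times Q\to\wp(Act)$ giving the (possibly empty) sets of available actions, a transition function $o$ giving a successor state $o(q,\sigma)$ for every $q\in Q$ and every joint action $\sigma\in D(q)=\prod_{a\in Agt}d(a,q)$, and $t:Act\times Res\to\mathbb Z$. Put $\mathsf{cons}(\alpha,r)=\max\{0,-t(\alpha,r)\}$ and $\mathsf{prod}(\alpha,r)=\max\{0,t(\alpha,r)\}$. *Formulas.* $\varphi,\psi::=p\mid\neg\varphi\mid\varphi\wedge\psi\mid\langle\langle A\rangle\rangle^{\eta}\bigcirc\varphi\mid\langle\langle A\rangle\rangle^{\eta}\Box\varphi\mid\langle\langle A\rangle\rangle^{\eta}\varphi\,\mathcal U\,\psi$,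 with $p\in\Pi$, $\emptyset\ne A\subseteq Agt$ and an endowment $\eta:Agt\times Res\to\mathbb N\cup\{\infty\}$. *Shares.* An $(A,\eta)$-share for a demand $\rho:Res\to\mathbb N$ is a function $\mathsf{sh}:A\times Res\to\mathbb N$ with $\mathsf{sh}(a,r)\le\eta_a(r)$ for all $a\in A$, $r\in Res$, and $\sum_{a\in A}\mathsf{sh}(a,r)=\rho(r)$ for all $r$ with $\rho(r)>0$ (lax convention), respectively for all $r$ (exact convention). *Paths.* A strategy $F_A$ maps every non-empty finite sequence of states, ending in $q$ say, to a tuple $(\alpha_a)_{a\in A}$ of actions, with $\alpha_a\in d(a,q)$ for all $a\in A$ whenever these sets are all non-empty. An $(\eta,F_A)$-sequence from $q$ is a non-empty finite or infinite sequence $(q_0,\eta^0),(q_1,\eta^1),\dots$ of states and endowments with $(q_0,\eta^0)=(q,\eta)$ such that for every two consecutive entries with indices $i,i+1$ there are $\sigma\in D(q_i)$ with $\sigma_a=F_A(q_0\dots q_i)_a$ for all $a\in A$ and $o(q_i,\sigma)=q_{i+1}$, and an $(A,\eta^i)$-share $\mathsf{sh}$ for the demand $r\mapsto\sum_{a\in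 A}\mathsf{cons}(\sigma_a,r)$, with $\eta^{i+1}_a(r)=\eta^i_a(r)+\mathsf{prod}(\sigma_a,r)-\mathsf{sh}(a,r)$ for all $a\in A$, $r\in Res$. The set $out(q,\eta,F_A)$ consists of the maximal $(\eta,F_A)$-sequences from $q$, that is, those which are not a proper prefix of another one. Write $|\lambda|$ for the number of entries of $\lambda$ and $\lambda[i]$ for its $i$-th state, counted from $0$. *Finite semantics.* $M,q\models p$ iff $p\in\pi(q)$; negation and conjunction are as usual; and - $M,q\models\langle\langle A\rangle\rangle^{\eta}\bigcirc\varphi$ iff there is $F_A$ such that every $\lambda\in out(q,\eta,F_A)$ satisfies $|\lambda|\ge2$ and $M,\lambda[1]\models\varphi$; - $M,q\models\langle\langle A\rangle\rangle^{\eta}\Box\varphi$ iff there is $F_A$ such that every $\lambda\in out(q,\eta,F_A)$ is infinite and $M,\lambda[i]\models\varphi$ for all $i\ge0$; - $M,q\models\langle\langle A\rangle\rangle^{\eta}\varphi\,\mathcal U\,\psi$ iff there is $F_A$ such that for every $\lambda\in out(q,\eta,F_A)$ there is $i$ with $0\le i<|\lambda|$, $M,\lambda[i]\models\psi$, and $M,\lambda[j]\models\varphi$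 for all $0\le j<i$. -/

import Mathlib

open scoped BigOperators

namespace RAL

/-- An endowment gives every agent an amount in `ℕ ∪ {∞}` of every resource. -/
abbrev Endowment (Agt Res : Type*) := Agt → Res → ℕ∞

/-- Formulas of pr-rf-RAL'. The three modalities carry a non-empty coalition and an endowment. -/
inductive Formula (Agt Prp Res : Type*) where
  | prop (p : Prp) : Formula Agt Prp Res
  | neg (φ : Formula Agt Prp Res) : Formula Agt Prp Res
  | and (φ ψ : Formula Agt Prp Res) : Formula Agt Prp Res
  | next (A : Finset Agt) (hA : A.Nonempty) (η : Endowment Agt Res)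
      (φ : Formula Agt Prp Res) : Formula Agt Prp Res
  | always (A : Finset Agt) (hA : A.Nonempty) (η : Endowment Agt Res)
      (φ : Formula Agt Prp Res) : Formula Agt Prp Res
  | until (A : Finset Agt) (hA : A.Nonempty) (η : Endowment Agt Res)
      (φ ψ : Formula Agt Prp Res) : Formula Agt Prp Res

/-- Resource-bounded models. `avail a q` may be empty. The transition function `step q` matters
only on the joint actions that are available at `q`; its other values are never used. -/
structure RBM (Agt Q Prp Act Res : Type*) where
  /-- the propositions true at a state -/
  val : Q → Finset Prp
  /-- the actions available to an agent at a state -/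
  avail : Agt → Q → Finset Act
  /-- the successor state under a joint action of all agents -/
  step : Q → (Agt → Act) → Q
  /-- the effect of an action on a resource: consumption if `≤ 0`, production if `> 0` -/
  t : Act → Res → ℤ

section Semantics

variable {Agt Q Prp Act Res : Type*}

/-- `cons(α, r) = -min {0, t(α, r)}`. -/
def RBM.cons (M : RBM Agt Q Prp Act Res) (α : Act) (r : Res) : ℕ := (-(M.t α r)).toNat

/-- `prod(α, r) = max {0, t(α, r)}`. -/
def RBM.prod (M : RBM Agt Q Prp Act Res) (α : Act) (r : Res) : ℕ := (M.t α r).toNat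

/-- What a share may do with a resource for which there is no demand: under `lax` there is no
constraint on the sum of the contributions to such a resource (so it may be partly lost), under
`exact` the contributions sum to the demand, that is, to zero. -/
inductive ShareRule where
  | lax
  | exact

/-- `sh` is an `(A, η)`-share for the demand `ρ`. -/
def IsShare (rule : ShareRule) (A : Finset Agt) (η : Endowment Agt Res) (ρ : Res → ℕ)
    (sh : Agt → Res → ℕ) : Prop :=
  (∀ r, (0 < ρ r ∨ rule = ShareRule.exact) → ∑ a ∈ A, sh a r = ρ r) ∧
    ∀ a ∈ A, ∀ r, (sh a r : ℕ∞) ≤ η a r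

/-- A perfect recall strategy for `A`: it maps each non-empty finite history to a tuple of actions
for the members of `A`, which has to be available at the last state of the history whenever the
coalition has some available tuple there. -/
structure Strategy (M : RBM Agt Q Prp Act Res) (A : Finset Agt) where
  act : List Q → A → Act
  act_mem : ∀ (h : List Q) (q : Q), (∀ a : A, (M.avail a q).Nonempty) →
    ∀ a : A, act (h ++ [q]) a ∈ M.avail a q

/-- Non-empty finite or infinite sequences over states and endowments. Only the entries with index
below `length` are meaningful. -/
structure RPath (Agt Q Res : Type*) where
  length : ℕ∞
  length_pos : 0 < length
  state : ℕ → Q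
  endow : ℕ → Endowment Agt Res

/-- The history `q₀ … qᵢ`. -/
def RPath.history (p : RPath Agt Q Res) (i : ℕ) : List Q := (List.range (i + 1)).map p.state

/-- One step from `(q, η)` to `(q', η')` in which the coalition plays `α`. The coalition pays its
total consumption by a share from `η`, and each member receives its own production. Endowments of
agents outside `A` are unconstrained. The equation for `η'` is written without subtraction. -/
def Move (rule : ShareRule) (M : RBM Agt Q Prp Act Res) (A : Finset Agt) (α : A → Act)
    (q : Q) (η : Endowment Agt Res) (q' : Q) (η' : Endowment Agt Res) : Prop :=
  ∃ σ : Agt → Act, (∀ b, σ b ∈ M.avail b q) ∧ (∀ a : A, α a = σ a) ∧ M.step q σ = q' ∧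
    ∃ sh : Agt → Res → ℕ, IsShare rule A η (fun r => ∑ a ∈ A, M.cons (σ a) r) sh ∧
      ∀ a ∈ A, ∀ r, η' a r + (sh a r : ℕ∞) = η a r + (M.prod (σ a) r : ℕ∞)

/-- `p` starts in `(q, η)` and all its steps are moves under the strategy `F`. -/
def Follows (rule : ShareRule) (M : RBM Agt Q Prp Act Res) (A : Finset Agt) (F : Strategy M A)
    (q : Q) (η : Endowment Agt Res) (p : RPath Agt Q Res) : Prop :=
  p.state 0 = q ∧ p.endow 0 = η ∧
    ∀ i : ℕ, ((i + 1 : ℕ) : ℕ∞) < p.length →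
      Move rule M A (F.act (p.history i)) (p.state i) (p.endow i) (p.state (i + 1)) (p.endow (i + 1))

/-- `p'` is a proper extension of `p`. -/
def RPath.Extends (p' p : RPath Agt Q Res) : Prop :=
  p.length < p'.length ∧
    ∀ i : ℕ, (i : ℕ∞) < p.length → p'.state i = p.state i ∧ p'.endow i = p.endow i

/-- The set `out(q, η, F_A)` of maximal paths: a path that can be extended must be extended. -/
def out (rule : ShareRule) (M : RBM Agt Q Prp Act Res) (A : Finset Agt) (F : Strategy M A)
    (q : Q) (η : Endowment Agt Res) : Set (RPath Agt Q Res) :=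
  {p | Follows rule M A F q η p ∧ ¬ ∃ p', Follows rule M A F q η p' ∧ p'.Extends p}

/-- Truth of a formula at a state, under finite semantics. -/
def Sat (rule : ShareRule) (M : RBM Agt Q Prp Act Res) : Formula Agt Prp Res → Q → Prop
  | .prop x, q => x ∈ M.val q
  | .neg φ, q => ¬ Sat rule M φ q
  | .and φ ψ, q => Sat rule M φ q ∧ Sat rule M ψ q
  | .next A _ η φ, q => ∃ F : Strategy M A, ∀ p ∈ out rule M A F q η,
      2 ≤ p.length ∧ Sat rule M φ (p.state 1)
  | .always A _ η φ, q => ∃ F : Strategy M A, ∀ p ∈ out rule M A F q η,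
      p.length = ⊤ ∧ ∀ i : ℕ, Sat rule M φ (p.state i)
  | .until A _ η φ ψ, q => ∃ F : Strategy M A, ∀ p ∈ out rule M A F q η,
      ∃ i : ℕ, (i : ℕ∞) < p.length ∧ Sat rule M ψ (p.state i) ∧
        ∀ j < i, Sat rule M φ (p.state j)

end Semantics

/-- Inputs of the model-checking problem: a finite model, a state and a formula. Agents, states,
propositions, actions and resources are numbered. -/
structure Input where
  agents : ℕ
  states : ℕ
  props : ℕ
  actions : ℕ
  resources : ℕ
  agents_pos : 0 < agents
  actions_pos : 0 < actions
  resources_pos : 0 < resources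
  model : RBM (Fin agents) (Fin states) (Fin props) (Fin actions) (Fin resources)
  state : Fin states
  formula : Formula (Fin agents) (Fin props) (Fin resources)

/-- The characteristic vector of a finite set. -/
def bits {n : ℕ} (S : Finset (Fin n)) : List Bool := List.ofFn fun i => decide (i ∈ S)

/-- The table of an endowment, in which `none` stands for `∞`. -/
def endowmentCode {n r : ℕ} (η : Endowment (Fin n) (Fin r)) : List (List (Option ℕ)) :=
  List.ofFn fun a => List.ofFn fun x => if η a x = ⊤ then none else some (η a x).toNat

/-- The standard code of a formula as a natural number, by recursion on its syntax tree. -/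
def formulaCode {n k r : ℕ} : Formula (Fin n) (Fin k) (Fin r) → ℕ
  | .prop x => Nat.pair 0 x
  | .neg φ => Nat.pair 1 (formulaCode φ)
  | .and φ ψ => Nat.pair 2 (Nat.pair (formulaCode φ) (formulaCode ψ))
  | .next A _ η φ =>
      Nat.pair 3 (Nat.pair (Encodable.encode (bits A, endowmentCode η)) (formulaCode φ))
  | .always A _ η φ =>
      Nat.pair 4 (Nat.pair (Encodable.encode (bits A, endowmentCode η)) (formulaCode φ))
  | .until A _ η φ ψ =>
      Nat.pair 5 (Nat.pair (Encodable.encode (bits A, endowmentCode η))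
        (Nat.pair (formulaCode φ) (formulaCode ψ)))

/-- Codes of inputs: the five sizes, the tables of the valuation, of the available actions, of the
transition function and of the effects of actions (integers are written as sign and absolute
value), the number of the state, and the code of the formula. -/
abbrev Code :=
  (ℕ × ℕ × ℕ × ℕ × ℕ) × List (List Bool) × List (List (List Bool)) × List (List ℕ) ×
    List (List (Bool × ℕ)) × ℕ × ℕ

/-- The code of an input. Joint actions are listed through `finFunctionFinEquiv`, that is, as the
numbers below `actions ^ agents` written in base `actions`. -/
def Input.code (I : Input) : Code :=
  ((I.agents, I.states, I.props, I.actions, I.resources),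
    List.ofFn fun q => bits (I.model.val q),
    List.ofFn fun a => List.ofFn fun q => bits (I.model.avail a q),
    List.ofFn fun q => List.ofFn fun i : Fin (I.actions ^ I.agents) =>
      (I.model.step q (finFunctionFinEquiv.symm i) : ℕ),
    List.ofFn fun α => List.ofFn fun r =>
      (decide (I.model.t α r < 0), (I.model.t α r).natAbs),
    (I.state : ℕ),
    formulaCode I.formula)

/-- The model-checking problem, as the set of codes of the inputs with answer yes. -/
def ModelChecking (rule : ShareRule) (c : Code) : Prop :=
  ∃ I : Input, I.code = c ∧ Sat rule I.model I.formula I.state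

end RAL

/-!
The truth value of a coalition modality is the winner of a turn-based game with perfect information
in which the coalition owns a vector of resources. Two observations lead there.

First, only the sum of what the members of the coalition own matters, because any demand up to this
sum can be shared (`exists_nat_sum_eq`), and the worst case among the shares is known: under the
exact convention all shares have the same sum, and under the lax convention the opponents let the
coalition lose everything it owns of the resources that it does not consume. A resource of which
some member owns infinitely much stays infinite and can be dropped. `Move.sound` and `Move.complete`
relate the moves of the model to those of the game `arena`.

Second, winning is monotone in the resources, and along a history of states the strategy itself
determines a lower bound of what is left, so that a strategy which sees the states only is as good
as one which sees the resources (`exists_strategy`). Thus `⟨⟨A⟩⟩ ○`, `⟨⟨A⟩⟩ □` and `⟨⟨A⟩⟩ U` become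
one forced move, a safety game and a reachability game (`forall_out_next_iff`,
`forall_out_always_iff`, `forall_out_until_iff`).

The outcome of these games has finite certificates for either winner. A reachability game that the
coalition wins, or a safety game that it loses, is decided after a bounded number of moves because
there are finitely many moves at each position, so a finite tree of plays is a certificate. In the
other two cases Dickson's lemma helps: the winning positions form an upward closed set, which has
finitely many minimal elements, and its complement is a finite union of sets of positions bounded
by vectors over `ℕ ∪ {∞}`. A finite set that is closed under the moves of the winner results
(`exists_entries_of_safe`, `exists_entries_of_not_reach`).

A certificate for a formula consists of such entries for all subformulas and all states, each entry
being justified by others. This is checked by the primitive recursive `Code.check`; its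
correctness is `Code.claims_sound` and `Code.exists_check_claims`. Hence the model-checking problem
and its complement, which also contains the codes that are not valid, are both recursively
enumerable, and the problem is decidable by Post's theorem.
-/

namespace RAL

/-! ### Turn-based games with resources -/

/-- A game played by a coalition that pays for its moves out of a vector of resources. A move
`m` stands for a joint action of all agents; the coalition settles on `m` up to `sim`, and the
opponents replace it by any available `m'` with `sim m m'`. The cost and the gain depend on the
coalition's part of the move only. A resource with `reset m r` is forfeited by the move, and what
is left of it afterwards is the gain. -/
structure Arena (Q Mv Res : Type*) where
  avail : Q → Mv → Prop
  sim : Mv → Mv → Prop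
  succ : Q → Mv → Q
  cost : Mv → Res → ℕ
  gain : Mv → Res → ℕ
  reset : Mv → Res → Prop

namespace Arena

variable {Q Mv Res : Type*} (G : Arena Q Mv Res)

open Classical in
/-- The resources that are left after the move `m`. -/
noncomputable def post (m : Mv) (w : Res → ℕ) (r : Res) : ℕ :=
  if G.reset m r then G.gain m r else w r - G.cost m r + G.gain m r

/-- The coalition has an affordable move after which `X` holds whatever the opponents do. -/
def Force (X : Q → (Res → ℕ) → Prop) (q : Q) (w : Res → ℕ) : Prop :=
  ∃ m, G.avail q m ∧ (∀ r, G.cost m r ≤ w r) ∧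
    ∀ m', G.avail q m' → G.sim m m' → X (G.succ q m') (G.post m w)

/-- The coalition reaches `T` through `P` in at most `k` moves. -/
def ReachIn (P T : Q → Prop) : ℕ → Q → (Res → ℕ) → Prop
  | 0, q, _ => T q
  | k + 1, q, w => T q ∨ P q ∧ G.Force (ReachIn P T k) q w

/-- The coalition stays in `P` for `k` moves. -/
def SafeFor (P : Q → Prop) : ℕ → Q → (Res → ℕ) → Prop
  | 0, q, _ => P q
  | k + 1, q, w => P q ∧ G.Force (SafeFor P k) q w

/-- The coalition reaches `T` through `P`. -/
def Reach (P T : Q → Prop) (q : Q) (w : Res → ℕ) : Prop := ∃ k, G.ReachIn P T k q w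

/-- The coalition stays in `P` for any number of moves. -/
def Safe (P : Q → Prop) (q : Q) (w : Res → ℕ) : Prop := ∀ k, G.SafeFor P k q w

variable {G}

theorem post_of_reset {m : Mv} {r : Res} (h : G.reset m r) (w : Res → ℕ) :
    G.post m w r = G.gain m r := if_pos h

theorem post_of_not_reset {m : Mv} {r : Res} (h : ¬ G.reset m r) (w : Res → ℕ) :
    G.post m w r = w r - G.cost m r + G.gain m r := if_neg h

theorem post_mono {m : Mv} {w w' : Res → ℕ} (h : ∀ r, w r ≤ w' r) (r : Res) :
    G.post m w r ≤ G.post m w' r := by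
  unfold post
  have := h r
  split_ifs <;> omega

theorem Force.imp {X Y : Q → (Res → ℕ) → Prop} (hXY : ∀ q w, X q w → Y q w) {q : Q}
    {w : Res → ℕ} (h : G.Force X q w) : G.Force Y q w := by
  obtain ⟨m, h1, h2, h3⟩ := h
  exact ⟨m, h1, h2, fun m' a b => hXY _ _ (h3 m' a b)⟩

theorem Force.mono {X : Q → (Res → ℕ) → Prop}
    (hX : ∀ q w w', (∀ r, w r ≤ w' r) → X q w → X q w') {q : Q} {w w' : Res → ℕ}
    (hw : ∀ r, w r ≤ w' r) (h : G.Force X q w) : G.Force X q w' := by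
  obtain ⟨m, h1, h2, h3⟩ := h
  exact ⟨m, h1, fun r => (h2 r).trans (hw r),
    fun m' a b => hX _ _ _ (post_mono hw) (h3 m' a b)⟩

theorem not_force {X : Q → (Res → ℕ) → Prop} {q : Q} {w : Res → ℕ} (h : ¬ G.Force X q w) {m : Mv}
    (hm : G.avail q m) (hc : ∀ r, G.cost m r ≤ w r) :
    ∃ m', G.avail q m' ∧ G.sim m m' ∧ ¬ X (G.succ q m') (G.post m w) := by
  by_contra! h'
  exact h ⟨m, hm, hc, h'⟩

variable {P T : Q → Prop}

theorem ReachIn.mono : ∀ {k : ℕ} {q : Q} {w w' : Res → ℕ}, (∀ r, w r ≤ w' r) →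
    G.ReachIn P T k q w → G.ReachIn P T k q w'
  | 0, _, _, _, _, h => h
  | _ + 1, _, _, _, hw, h => h.imp_right fun h =>
    ⟨h.1, h.2.mono (X := G.ReachIn P T _) (fun _ _ _ hw h => ReachIn.mono hw h) hw⟩

theorem SafeFor.mono : ∀ {k : ℕ} {q : Q} {w w' : Res → ℕ}, (∀ r, w r ≤ w' r) →
    G.SafeFor P k q w → G.SafeFor P k q w'
  | 0, _, _, _, _, h => h
  | _ + 1, _, _, _, hw, h =>
    ⟨h.1, h.2.mono (X := G.SafeFor P _) (fun _ _ _ hw h => SafeFor.mono hw h) hw⟩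

theorem Reach.mono {q : Q} {w w' : Res → ℕ} (hw : ∀ r, w r ≤ w' r) (h : G.Reach P T q w) :
    G.Reach P T q w' :=
  h.imp fun _ h => h.mono hw

theorem Safe.mono {q : Q} {w w' : Res → ℕ} (hw : ∀ r, w r ≤ w' r) (h : G.Safe P q w) :
    G.Safe P q w' :=
  fun k => (h k).mono hw

theorem ReachIn.succ : ∀ {k : ℕ} {q : Q} {w : Res → ℕ}, G.ReachIn P T k q w →
    G.ReachIn P T (k + 1) q w
  | 0, _, _, h => Or.inl h
  | _ + 1, _, _, h => h.imp_right fun h => ⟨h.1, h.2.imp fun _ _ => ReachIn.succ⟩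

theorem ReachIn.le {k l : ℕ} (hkl : k ≤ l) {q : Q} {w : Res → ℕ} (h : G.ReachIn P T k q w) :
    G.ReachIn P T l q w := by
  induction hkl with
  | refl => exact h
  | step _ ih => exact ih.succ

theorem SafeFor.of_succ : ∀ {k : ℕ} {q : Q} {w : Res → ℕ}, G.SafeFor P (k + 1) q w →
    G.SafeFor P k q w
  | 0, _, _, h => h.1
  | _ + 1, _, _, h => ⟨h.1, h.2.imp fun _ _ => SafeFor.of_succ⟩

theorem SafeFor.le {k l : ℕ} (hkl : k ≤ l) {q : Q} {w : Res → ℕ} (h : G.SafeFor P l q w) :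
    G.SafeFor P k q w := by
  induction hkl with
  | refl => exact h
  | step _ ih => exact ih h.of_succ

/-- The finitely many answers of the opponents to a move leave a common bound on the number of
moves that remain. -/
theorem reach_iff [Finite Mv] {q : Q} {w : Res → ℕ} :
    G.Reach P T q w ↔ T q ∨ P q ∧ G.Force (G.Reach P T) q w := by
  constructor
  · rintro ⟨_ | k, h⟩
    · exact Or.inl h
    · exact h.imp_right fun h => ⟨h.1, h.2.imp fun _ _ h => ⟨k, h⟩⟩
  · rintro (h | ⟨hP, m, h1, h2, h3⟩)
    · exact ⟨0, h⟩
    · choose! f hf using h3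
      obtain ⟨N, hN⟩ := Finite.exists_le f
      exact ⟨N + 1, Or.inr ⟨hP, m, h1, h2, fun m' a b => (hf m' a b).le (hN m')⟩⟩

/-- A coalition that is safe for any finite number of moves is so by a single move: there are
finitely many moves, and the bounds that refute them have a maximum. -/
theorem safe_iff [Finite Mv] {q : Q} {w : Res → ℕ} :
    G.Safe P q w ↔ P q ∧ G.Force (G.Safe P) q w := by
  constructor
  · intro h
    refine ⟨h 0, ?_⟩
    by_contra hF
    have H : ∀ m, ∃ k, G.avail q m → (∀ r, G.cost m r ≤ w r) →
        ∃ m', G.avail q m' ∧ G.sim m m' ∧ ¬ G.SafeFor P k (G.succ q m') (G.post m w) := by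
      intro m
      by_cases hm : G.avail q m ∧ ∀ r, G.cost m r ≤ w r
      · obtain ⟨m', a, b, c⟩ := not_force hF hm.1 hm.2
        obtain ⟨k, hk⟩ := not_forall.mp c
        exact ⟨k, fun _ _ => ⟨m', a, b, hk⟩⟩
      · exact ⟨0, fun a b => (hm ⟨a, b⟩).elim⟩
    choose f hf using H
    obtain ⟨N, hN⟩ := Finite.exists_le f
    obtain ⟨-, m, h1, h2, h3⟩ := h (N + 1)
    obtain ⟨m', a, b, c⟩ := hf m h1 h2
    exact c ((h3 m' a b).le (hN m))
  · rintro ⟨hP, hF⟩ (_ | k)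
    · exact hP
    · exact ⟨hP, hF.imp fun _ _ h => h k⟩

end Arena

/-! ### Shares and the total endowment of a coalition -/

section Semantics

variable {Agt Q Prp Act Res : Type*}

/-- What the coalition `A` owns of a resource. -/
def total (A : Finset Agt) (η : Endowment Agt Res) (r : Res) : ℕ∞ := ∑ a ∈ A, η a r

/-- What the coalition `A` owns of a resource, and `0` if that is infinite. -/
def budget (A : Finset Agt) (η : Endowment Agt Res) (r : Res) : ℕ := (total A η r).toNat

/-- A demand that does not exceed what is owned in total can be shared. -/
theorem exists_nat_sum_eq (A : Finset Agt) (f : Agt → ℕ∞) (n : ℕ) (h : (n : ℕ∞) ≤ ∑ a ∈ A, f a) :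
    ∃ g : Agt → ℕ, (∀ a ∈ A, (g a : ℕ∞) ≤ f a) ∧ ∑ a ∈ A, g a = n := by
  classical
  induction A using Finset.induction_on generalizing n with
  | empty =>
    refine ⟨fun _ => 0, by simp, ?_⟩
    simpa [eq_comm] using h
  | insert b A hb ih =>
    rw [Finset.sum_insert hb] at h
    obtain ⟨k, hk, hkb, hkn⟩ : ∃ k : ℕ, k ≤ n ∧ (k : ℕ∞) ≤ f b ∧
        ((n - k : ℕ) : ℕ∞) ≤ ∑ a ∈ A, f a := by
      induction hfb : f b using ENat.recTopCoe with
      | top => exact ⟨n, le_rfl, le_top, by simp⟩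
      | coe x =>
        refine ⟨min x n, min_le_right _ _, by exact_mod_cast min_le_left _ _, ?_⟩
        rw [hfb] at h
        induction hs : ∑ a ∈ A, f a using ENat.recTopCoe with
        | top => exact le_top
        | coe y =>
          rw [hs] at h
          norm_cast at h ⊢
          omega
    obtain ⟨g, hg, hgs⟩ := ih (n - k) hkn
    refine ⟨fun a => if a = b then k else g a, ?_, ?_⟩
    · intro a ha
      rcases Finset.mem_insert.mp ha with rfl | ha'
      · simpa using hkb
      · have : a ≠ b := fun e => hb (e ▸ ha')
        simpa [this] using hg a ha'
    · rw [Finset.sum_insert hb]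
      have : ∑ a ∈ A, (if a = b then k else g a) = ∑ a ∈ A, g a :=
        Finset.sum_congr rfl fun a ha => by simp [show a ≠ b from fun e => hb (e ▸ ha)]
      simp only [this, if_true, hgs]
      omega

open Classical in
/-- The game behind a coalition modality. Joint actions that agree on `A` are similar. A resource
of which the coalition owns infinitely much is free and plays no role. Under the lax convention
the opponents may let the coalition forfeit each resource that it does not consume. -/
noncomputable def arena (rule : ShareRule) (M : RBM Agt Q Prp Act Res) (A : Finset Agt)
    (η : Endowment Agt Res) : Arena Q (Agt → Act) Res where
  avail q σ := ∀ b, σ b ∈ M.avail b q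
  sim σ σ' := ∀ a ∈ A, σ a = σ' a
  succ := M.step
  cost σ r := if total A η r = ⊤ then 0 else ∑ a ∈ A, M.cons (σ a) r
  gain σ r := if total A η r = ⊤ then 0 else ∑ a ∈ A, M.prod (σ a) r
  reset σ r := rule = ShareRule.lax ∧ (total A η r = ⊤ ∨ ∑ a ∈ A, M.cons (σ a) r = 0)

variable {rule : ShareRule} {M : RBM Agt Q Prp Act Res} {A : Finset Agt} {η : Endowment Agt Res}

theorem arena_post_of_top (σ : Agt → Act) {w : Res → ℕ} {r : Res} (h : total A η r = ⊤)
    (hw : w r = 0) : (arena rule M A η).post σ w r = 0 := by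
  by_cases h0 : (arena rule M A η).reset σ r
  · rw [Arena.post_of_reset h0]
    simp [arena, h]
  · rw [Arena.post_of_not_reset h0]
    simp [arena, h, hw]

theorem arena_post_of_forfeit (σ : Agt → Act) {w : Res → ℕ} {r : Res} (h : total A η r ≠ ⊤)
    (h0 : rule = ShareRule.lax ∧ ∑ a ∈ A, M.cons (σ a) r = 0) :
    (arena rule M A η).post σ w r = ∑ a ∈ A, M.prod (σ a) r := by
  rw [Arena.post_of_reset (show (arena rule M A η).reset σ r from ⟨h0.1, Or.inr h0.2⟩)]
  simp [arena, h]

theorem arena_post_of_demand (σ : Agt → Act) {w : Res → ℕ} {r : Res} (h : total A η r ≠ ⊤)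
    (h0 : 0 < ∑ a ∈ A, M.cons (σ a) r ∨ rule = ShareRule.exact) :
    (arena rule M A η).post σ w r =
      w r - ∑ a ∈ A, M.cons (σ a) r + ∑ a ∈ A, M.prod (σ a) r := by
  rw [Arena.post_of_not_reset]
  · simp [arena, h]
  · rintro ⟨h1, h2 | h2⟩
    · exact h h2
    · rcases h0 with h0 | h0
      · omega
      · simp [h1] at h0

/-- A demand of zero is the only one that does not determine the sum of a share, and only under
the lax convention. -/
theorem forfeit_or_demand (rule : ShareRule) (n : ℕ) :
    (rule = ShareRule.lax ∧ n = 0) ∨ (0 < n ∨ rule = ShareRule.exact) := by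
  cases rule
  · rcases n.eq_zero_or_pos with h | h <;> simp [h]
  · simp

theorem arena_post_congr {σ σ' : Agt → Act} (h : (arena rule M A η).sim σ σ') (w : Res → ℕ) :
    (arena rule M A η).post σ w = (arena rule M A η).post σ' w := by
  have h1 : ∀ r, ∑ a ∈ A, M.cons (σ a) r = ∑ a ∈ A, M.cons (σ' a) r := fun r =>
    Finset.sum_congr rfl fun a ha => by rw [h a ha]
  have h2 : ∀ r, ∑ a ∈ A, M.prod (σ a) r = ∑ a ∈ A, M.prod (σ' a) r := fun r =>
    Finset.sum_congr rfl fun a ha => by rw [h a ha]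
  funext r
  by_cases h0 : (arena rule M A η).reset σ r
  · have h0' : (arena rule M A η).reset σ' r := ⟨h0.1, h1 r ▸ h0.2⟩
    rw [Arena.post_of_reset h0, Arena.post_of_reset h0']
    simp only [arena, h2]
  · have h0' : ¬ (arena rule M A η).reset σ' r := fun hn => h0 ⟨hn.1, (h1 r).symm ▸ hn.2⟩
    rw [Arena.post_of_not_reset h0, Arena.post_of_not_reset h0']
    simp only [arena, h1, h2]

theorem arena_cost_congr {σ σ' : Agt → Act} (h : (arena rule M A η).sim σ σ') (r : Res) :
    (arena rule M A η).cost σ r = (arena rule M A η).cost σ' r := by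
  have h1 : ∑ a ∈ A, M.cons (σ a) r = ∑ a ∈ A, M.cons (σ' a) r :=
    Finset.sum_congr rfl fun a ha => by rw [h a ha]
  simp only [arena, h1]

theorem total_eq_budget {r : Res} (h : total A η r ≠ ⊤) : total A η r = budget A η r :=
  (ENat.natCast_toNat h).symm

theorem total_eq_top_iff {r : Res} : total A η r = ⊤ ↔ ∃ a ∈ A, η a r = ⊤ := by
  unfold total
  exact WithTop.sum_eq_top

/-- A move consists of available actions that the coalition can pay for, and leaves it at least
what the game does. -/
theorem Move.sound {α : A → Act} {q q' : Q} {θ θ' : Endowment Agt Res}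
    (hθ : ∀ r, total A θ r = ⊤ ↔ total A η r = ⊤) (h : Move rule M A α q θ q' θ') :
    ∃ σ, (arena rule M A η).avail q σ ∧ (∀ a : A, α a = σ a) ∧ M.step q σ = q' ∧
      (∀ r, (arena rule M A η).cost σ r ≤ budget A θ r) ∧
      (∀ r, total A θ' r = ⊤ ↔ total A η r = ⊤) ∧
      ∀ r, (arena rule M A η).post σ (budget A θ) r ≤ budget A θ' r := by
  obtain ⟨σ, h1, h2, h3, sh, ⟨hsh, hle⟩, heq⟩ := h
  beta_reduce at hsh
  have hsum : ∀ r, total A θ' r + ((∑ a ∈ A, sh a r : ℕ) : ℕ∞) =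
      total A θ r + ((∑ a ∈ A, M.prod (σ a) r : ℕ) : ℕ∞) := by
    intro r
    push_cast
    rw [total, total, ← Finset.sum_add_distrib, ← Finset.sum_add_distrib]
    exact Finset.sum_congr rfl fun a ha => heq a ha r
  have hshle : ∀ r, ((∑ a ∈ A, sh a r : ℕ) : ℕ∞) ≤ total A θ r := by
    intro r
    push_cast
    exact Finset.sum_le_sum fun a ha => hle a ha r
  have htop : ∀ r, total A θ' r = ⊤ ↔ total A η r = ⊤ := by
    intro r
    rw [← hθ r]
    have := hsum r
    constructor <;> intro ht <;> rw [ht] at this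
    · by_contra hn
      rw [total_eq_budget hn] at this
      exact absurd this.symm (by exact_mod_cast ENat.natCast_ne_top _)
    · by_contra hn
      rw [total_eq_budget hn] at this
      exact absurd this (by exact_mod_cast ENat.natCast_ne_top _)
  have key : ∀ r, total A η r ≠ ⊤ →
      budget A θ' r + ∑ a ∈ A, sh a r = budget A θ r + ∑ a ∈ A, M.prod (σ a) r ∧
      ∑ a ∈ A, sh a r ≤ budget A θ r := by
    intro r hr
    have a1 := hsum r
    have a2 := hshle r
    rw [total_eq_budget (mt (hθ r).1 hr)] at a1 a2
    rw [total_eq_budget (mt (htop r).1 hr)] at a1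
    exact ⟨by exact_mod_cast a1, by exact_mod_cast a2⟩
  refine ⟨σ, h1, h2, h3, ?_, htop, ?_⟩
  · intro r
    by_cases hr : total A η r = ⊤
    · simp [arena, hr]
    · have b := key r hr
      have c := hsh r
      simp only [arena, hr, if_false]
      rcases Nat.eq_zero_or_pos (∑ a ∈ A, M.cons (σ a) r) with h0 | h0
      · omega
      · have := c (Or.inl h0)
        omega
  · intro r
    by_cases hr : total A η r = ⊤
    · have : budget A θ r = 0 := by simp [budget, (hθ r).2 hr]
      simp [arena_post_of_top σ hr this]
    · have b := key r hr
      have c := hsh r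
      rcases forfeit_or_demand rule (∑ a ∈ A, M.cons (σ a) r) with h0 | h0
      · rw [arena_post_of_forfeit σ hr h0]
        omega
      · rw [arena_post_of_demand σ hr h0]
        have := c h0
        omega

/-- Every affordable joint action can be played so that the coalition keeps exactly what the game
leaves it: under the lax convention it forfeits all it owns of the resources not consumed. -/
theorem Move.complete {q : Q} {θ : Endowment Agt Res}
    (hθ : ∀ r, total A θ r = ⊤ ↔ total A η r = ⊤) {σ : Agt → Act}
    (hσ : (arena rule M A η).avail q σ) (hc : ∀ r, (arena rule M A η).cost σ r ≤ budget A θ r) :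
    ∃ θ', Move rule M A (fun a => σ a) q θ (M.step q σ) θ' ∧
      (∀ r, total A θ' r = ⊤ ↔ total A η r = ⊤) ∧
      budget A θ' = (arena rule M A η).post σ (budget A θ) := by
  have H : ∀ r, ∃ f : Agt → ℕ, (∀ a ∈ A, (f a : ℕ∞) ≤ θ a r) ∧
      ((0 < ∑ a ∈ A, M.cons (σ a) r ∨ rule = ShareRule.exact) →
        ∑ a ∈ A, f a = ∑ a ∈ A, M.cons (σ a) r) ∧
      (total A η r ≠ ⊤ → rule = ShareRule.lax → ∑ a ∈ A, M.cons (σ a) r = 0 →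
        ∑ a ∈ A, f a = budget A θ r) := by
    intro r
    by_cases hr : total A η r ≠ ⊤ ∧ rule = ShareRule.lax ∧ ∑ a ∈ A, M.cons (σ a) r = 0
    · obtain ⟨g, hg, hgs⟩ := exists_nat_sum_eq A (fun a => θ a r) (budget A θ r)
        (total_eq_budget (mt (hθ r).1 hr.1)).symm.le
      refine ⟨g, hg, ?_, fun _ _ _ => hgs⟩
      rintro (h | h)
      · omega
      · simp [hr.2.1] at h
    · have hle : ((∑ a ∈ A, M.cons (σ a) r : ℕ) : ℕ∞) ≤ ∑ a ∈ A, θ a r := by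
        by_cases ht : total A η r = ⊤
        · change _ ≤ total A θ r
          simp [(hθ r).2 ht]
        · have := hc r
          simp only [arena, ht, if_false] at this
          change _ ≤ total A θ r
          rw [total_eq_budget (mt (hθ r).1 ht)]
          exact_mod_cast this
      obtain ⟨g, hg, hgs⟩ := exists_nat_sum_eq A (fun a => θ a r) _ hle
      exact ⟨g, hg, fun _ => hgs, fun a b c => (hr ⟨a, b, c⟩).elim⟩
  choose f hf1 hf2 hf3 using H
  let θ' : Endowment Agt Res := fun a r => θ a r + (M.prod (σ a) r : ℕ∞) - (f r a : ℕ∞)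
  have hM : Move rule M A (fun a => σ a) q θ (M.step q σ) θ' := by
    refine ⟨σ, hσ, fun _ => rfl, rfl, fun a r => f r a, ⟨fun r hr => hf2 r hr,
      fun a ha r => hf1 r a ha⟩, ?_⟩
    intro a ha r
    exact tsub_add_cancel_of_le ((hf1 r a ha).trans le_self_add)
  refine ⟨θ', hM, ?_⟩
  have hsum : ∀ r, total A θ' r + ((∑ a ∈ A, f r a : ℕ) : ℕ∞) =
      total A θ r + ((∑ a ∈ A, M.prod (σ a) r : ℕ) : ℕ∞) := by
    intro r
    push_cast
    rw [total, total, ← Finset.sum_add_distrib, ← Finset.sum_add_distrib]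
    exact Finset.sum_congr rfl fun a ha =>
      tsub_add_cancel_of_le ((hf1 r a ha).trans le_self_add)
  obtain ⟨-, -, -, -, -, htop, -⟩ := Move.sound hθ hM
  refine ⟨htop, ?_⟩
  funext r
  by_cases hr : total A η r = ⊤
  · have h1 : budget A θ r = 0 := by simp [budget, (hθ r).2 hr]
    have h2 : budget A θ' r = 0 := by simp [budget, (htop r).2 hr]
    rw [h2, arena_post_of_top σ hr h1]
  · have a1 := hsum r
    rw [total_eq_budget (mt (hθ r).1 hr), total_eq_budget (mt (htop r).1 hr)] at a1
    have a2 : budget A θ' r + ∑ a ∈ A, f r a = budget A θ r + ∑ a ∈ A, M.prod (σ a) r := by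
      exact_mod_cast a1
    have a3 := hc r
    simp only [arena, hr, if_false] at a3
    rcases forfeit_or_demand rule (∑ a ∈ A, M.cons (σ a) r) with h0 | h0
    · rw [arena_post_of_forfeit σ hr h0]
      have := hf3 r hr h0.1 h0.2
      omega
    · rw [arena_post_of_demand σ hr h0]
      have := hf2 r h0
      omega

end Semantics

/-! ### Maximal paths -/

section Paths

variable {Agt Q Prp Act Res : Type*} {rule : ShareRule} {M : RBM Agt Q Prp Act Res}
  {A : Finset Agt} {η : Endowment Agt Res} {q : Q}

theorem RPath.history_congr {p p' : RPath Agt Q Res} {i : ℕ}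
    (h : ∀ j ≤ i, p.state j = p'.state j) : p.history i = p'.history i := by
  refine List.map_congr_left fun j hj => h j ?_
  rw [List.mem_range] at hj
  omega

theorem RPath.history_eq (p : RPath Agt Q Res) (i : ℕ) :
    p.history i = (List.range i).map p.state ++ [p.state i] := by
  simp [RPath.history, List.range_succ]

/-- A maximal path goes on as long as there is a move. -/
theorem lt_length_of_mem_out {F : Strategy M A} {p : RPath Agt Q Res}
    (hp : p ∈ out rule M A F q η) {i : ℕ} (hi : (i : ℕ∞) < p.length) {q' : Q}
    {η' : Endowment Agt Res}
    (h : Move rule M A (F.act (p.history i)) (p.state i) (p.endow i) q' η') :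
    ((i + 1 : ℕ) : ℕ∞) < p.length := by
  by_contra hlt
  have hlen : p.length = ((i + 1 : ℕ) : ℕ∞) := by
    refine le_antisymm (not_lt.mp hlt) ?_
    rw [Nat.cast_add, Nat.cast_one]
    exact Order.add_one_le_of_lt hi
  obtain ⟨⟨h0, h1, h2⟩, hmax⟩ := hp
  let p' : RPath Agt Q Res :=
    { length := ((i + 2 : ℕ) : ℕ∞)
      length_pos := by exact_mod_cast Nat.succ_pos _
      state := fun j => if j ≤ i then p.state j else q'
      endow := fun j => if j ≤ i then p.endow j else η' }
  have hh : ∀ j ≤ i, p'.history j = p.history j := fun j hj =>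
    RPath.history_congr fun l hl => if_pos (hl.trans hj)
  refine hmax ⟨p', ⟨by simpa [p'] using h0, by simpa [p'] using h1, ?_⟩, ?_, ?_⟩
  · intro j hj
    have hj' : j + 1 < i + 2 := by
      change ((j + 1 : ℕ) : ℕ∞) < ((i + 2 : ℕ) : ℕ∞) at hj
      exact_mod_cast hj
    rw [hh j (by omega)]
    have e1 : p'.state j = p.state j := if_pos (by omega)
    have e2 : p'.endow j = p.endow j := if_pos (by omega)
    rw [e1, e2]
    rcases Nat.lt_or_ge j i with hji | hji
    · have e3 : p'.state (j + 1) = p.state (j + 1) := if_pos (by omega)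
      have e4 : p'.endow (j + 1) = p.endow (j + 1) := if_pos (by omega)
      rw [e3, e4]
      exact h2 j (by rw [hlen]; exact_mod_cast Nat.succ_lt_succ hji)
    · obtain rfl : j = i := by omega
      have e3 : p'.state (j + 1) = q' := if_neg (by omega)
      have e4 : p'.endow (j + 1) = η' := if_neg (by omega)
      rw [e3, e4]
      exact h
  · rw [hlen]
    change ((i + 1 : ℕ) : ℕ∞) < ((i + 2 : ℕ) : ℕ∞)
    exact_mod_cast Nat.lt_succ_self _
  · intro j hj
    rw [hlen] at hj
    have hj' : j < i + 1 := by exact_mod_cast hj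
    exact ⟨if_pos (by omega), if_pos (by omega)⟩

/-- The opponents and the shares can be played so as to maintain `J` whenever that is possible. -/
theorem exists_mem_out_of_preference (F : Strategy M A) (q : Q) (η : Endowment Agt Res)
    (J : ℕ → Q → Endowment Agt Res → Prop) :
    ∃ p ∈ out rule M A F q η, ∀ i : ℕ, ((i + 1 : ℕ) : ℕ∞) < p.length →
      (∃ q' η', Move rule M A (F.act (p.history i)) (p.state i) (p.endow i) q' η' ∧
        J (i + 1) q' η') → J (i + 1) (p.state (i + 1)) (p.endow (i + 1)) := by
  classical
  let St (h : List Q) (x y : Q × Endowment Agt Res) : Prop :=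
    Move rule M A (F.act (h ++ [x.1])) x.1 x.2 y.1 y.2
  have H : ∀ (n : ℕ) (h : List Q) (x : Q × Endowment Agt Res), ∃ y,
      ((∃ y, St h x y) → St h x y) ∧ ((∃ y, St h x y ∧ J n y.1 y.2) → J n y.1 y.2) := by
    intro n h x
    by_cases h1 : ∃ y, St h x y ∧ J n y.1 y.2
    · obtain ⟨y, hy⟩ := h1
      exact ⟨y, fun _ => hy.1, fun _ => hy.2⟩
    · by_cases h2 : ∃ y, St h x y
      · obtain ⟨y, hy⟩ := h2
        exact ⟨y, fun _ => hy, fun h => (h1 h).elim⟩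
      · exact ⟨x, fun h => (h2 h).elim, fun h => (h1 h).elim⟩
  choose nxt hnxt1 hnxt2 using H
  let s : ℕ → List Q × (Q × Endowment Agt Res) := fun n =>
    Nat.rec ([], (q, η)) (fun n x => (x.1 ++ [x.2.1], nxt (n + 1) x.1 x.2)) n
  have hs : ∀ n, s (n + 1) = ((s n).1 ++ [(s n).2.1], nxt (n + 1) (s n).1 (s n).2) := fun _ => rfl
  have hs1 : ∀ n, (s n).1 = (List.range n).map fun i => (s i).2.1 := by
    intro n
    induction n with
    | zero => rfl
    | succ n ih => rw [hs, List.range_succ, List.map_append, ← ih]; rfl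
  let stuck (n : ℕ) : Prop := ¬ ∃ y, St (s n).1 (s n).2 y
  obtain ⟨len, hpos, hlen1, hlen2⟩ : ∃ len : ℕ∞, 0 < len ∧
      (∀ i : ℕ, ((i + 1 : ℕ) : ℕ∞) < len → ¬ stuck i) ∧
      (len ≠ ⊤ → ∃ n : ℕ, len = ((n + 1 : ℕ) : ℕ∞) ∧ stuck n) := by
    by_cases h : ∃ n, stuck n
    · refine ⟨((Nat.find h + 1 : ℕ) : ℕ∞), by exact_mod_cast Nat.succ_pos _, ?_,
        fun _ => ⟨_, rfl, Nat.find_spec h⟩⟩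
      intro i hi
      have hi' : i + 1 < Nat.find h + 1 := by exact_mod_cast hi
      exact Nat.find_min h (by omega)
    · exact ⟨⊤, by simp, fun i _ hi => h ⟨i, hi⟩, fun h => (h rfl).elim⟩
  let p : RPath Agt Q Res := ⟨len, hpos, fun n => (s n).2.1, fun n => (s n).2.2⟩
  have hist : ∀ i, p.history i = (s i).1 ++ [(s i).2.1] := by
    intro i
    rw [RPath.history_eq, hs1]
  refine ⟨p, ⟨⟨rfl, rfl, ?_⟩, ?_⟩, ?_⟩
  · intro i hi
    rw [hist]
    have := hnxt1 (i + 1) (s i).1 (s i).2 (not_not.mp (hlen1 i hi))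
    rwa [show nxt (i + 1) (s i).1 (s i).2 = (s (i + 1)).2 by rw [hs]] at this
  · rintro ⟨p', ⟨-, -, h3⟩, h4, h5⟩
    have hne : len ≠ ⊤ := ne_top_of_lt h4
    obtain ⟨n, hn, hst⟩ := hlen2 hne
    have hpn : p.length = ((n + 1 : ℕ) : ℕ∞) := hn
    have hlt : ∀ j ≤ n, (j : ℕ∞) < p.length := by
      intro j hj
      rw [hpn]
      exact_mod_cast Nat.lt_succ_of_le hj
    have hm := h3 n (hpn ▸ h4)
    rw [RPath.history_congr (p' := p) fun j hj => (h5 j (hlt j hj)).1, (h5 n (hlt n le_rfl)).1,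
      (h5 n (hlt n le_rfl)).2, hist] at hm
    exact hst ⟨(_, _), hm⟩
  · rintro i - ⟨q', η', hm, hJ⟩
    rw [hist] at hm
    have := hnxt2 (i + 1) (s i).1 (s i).2 ⟨(q', η'), hm, hJ⟩
    rwa [show nxt (i + 1) (s i).1 (s i).2 = (s (i + 1)).2 by rw [hs]] at this

/-- Against any strategy the opponents can maintain an invariant `D` of the game, for as long as
the path goes on and stays in `Ok`, if the coalition cannot force it to fail. -/
theorem exists_mem_out_of_opponent (F : Strategy M A) (Ok : ℕ → Q → Prop)
    (D : ℕ → Q → (Res → ℕ) → Prop)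
    (hD : ∀ i q w, D i q w → Ok i q →
      ¬ (arena rule M A η).Force (fun q' w' => ¬ D (i + 1) q' w') q w)
    (h0 : D 0 q (budget A η)) :
    ∃ p ∈ out rule M A F q η, p.state 0 = q ∧ ∀ i : ℕ, (i : ℕ∞) < p.length →
      (∀ j < i, Ok j (p.state j)) → D i (p.state i) (budget A (p.endow i)) := by
  obtain ⟨p, hp, hJ⟩ := exists_mem_out_of_preference (rule := rule) F q η fun i q' η' =>
    (∀ r, total A η' r = ⊤ ↔ total A η r = ⊤) ∧ D i q' (budget A η')
  refine ⟨p, hp, hp.1.1, ?_⟩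
  have key : ∀ i : ℕ, (i : ℕ∞) < p.length → (∀ j < i, Ok j (p.state j)) →
      (∀ r, total A (p.endow i) r = ⊤ ↔ total A η r = ⊤) ∧
        D i (p.state i) (budget A (p.endow i)) := by
    intro i
    induction i with
    | zero =>
      intro _ _
      rw [hp.1.1, hp.1.2.1]
      exact ⟨fun _ => Iff.rfl, h0⟩
    | succ i ih =>
      intro hi hok
      obtain ⟨hη, hDi⟩ := ih (lt_trans (by exact_mod_cast Nat.lt_succ_self i) hi)
        fun j hj => hok j (hj.trans (Nat.lt_succ_self i))
      refine hJ i hi ?_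
      obtain ⟨σ, a1, a2, -, a4, -, -⟩ := Move.sound hη (hp.1.2.2 i hi)
      obtain ⟨σ', b1, b2, b3⟩ := Arena.not_force (hD i _ _ hDi (hok i (Nat.lt_succ_self i))) a1 a4
      obtain ⟨θ, c1, c2, c3⟩ := Move.complete hη b1 fun r => arena_cost_congr b2 r ▸ a4 r
      have hact : F.act (p.history i) = fun a : A => σ' a :=
        funext fun a => (a2 a).trans (b2 a a.2)
      refine ⟨_, θ, hact ▸ c1, c2, ?_⟩
      rw [c3, ← arena_post_congr b2]
      exact not_not.mp b3
  exact fun i hi hok => (key i hi hok).2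

/-- The coalition sees the states only, but together with its own moves they determine a lower
bound `v` of its budget. Hence it can follow a choice `μ` of moves that depends on the state and
this bound. -/
theorem exists_strategy [Nonempty Act] (μ : Q → (Res → ℕ) → Agt → Act) (q : Q)
    (η : Endowment Agt Res) :
    ∃ F : Strategy M A, ∀ p ∈ out rule M A F q η, ∃ v : ℕ → Res → ℕ, v 0 = budget A η ∧
      ∀ i : ℕ, (i : ℕ∞) < p.length →
        ((∀ r, total A (p.endow i) r = ⊤ ↔ total A η r = ⊤) ∧
          ∀ r, v i r ≤ budget A (p.endow i) r) →
        (arena rule M A η).avail (p.state i) (μ (p.state i) (v i)) →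
        (∀ r, (arena rule M A η).cost (μ (p.state i) (v i)) r ≤ v i r) →
        ((i + 1 : ℕ) : ℕ∞) < p.length ∧
        ((∀ r, total A (p.endow (i + 1)) r = ⊤ ↔ total A η r = ⊤) ∧
          ∀ r, v (i + 1) r ≤ budget A (p.endow (i + 1)) r) ∧
        v (i + 1) = (arena rule M A η).post (μ (p.state i) (v i)) (v i) ∧
        ∃ σ', (arena rule M A η).avail (p.state i) σ' ∧
          (arena rule M A η).sim (μ (p.state i) (v i)) σ' ∧
          p.state (i + 1) = (arena rule M A η).succ (p.state i) σ' := by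
  classical
  -- The lower bound after the states of a reversed list.
  let ℓ : List Q → Res → ℕ := fun l =>
    List.rec (budget A η) (fun q _ w => (arena rule M A η).post (μ q w) w) l
  let act : List Q → A → Act := fun h a =>
    match h.reverse with
    | [] => Classical.arbitrary Act
    | q :: past =>
      if μ q (ℓ past) a ∈ M.avail a q then μ q (ℓ past) a
      else if hne : (M.avail a q).Nonempty then hne.choose else Classical.arbitrary Act
  have hact : ∀ (l : List Q) (q : Q), act (l ++ [q]) = fun a : A =>
      if μ q (ℓ l.reverse) a ∈ M.avail a q then μ q (ℓ l.reverse) a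
      else if hne : (M.avail a q).Nonempty then hne.choose else Classical.arbitrary Act := by
    intro l q
    funext a
    simp only [act, List.reverse_append, List.reverse_cons, List.reverse_nil, List.nil_append,
      List.singleton_append]
  refine ⟨⟨act, ?_⟩, ?_⟩
  · intro l q hne a
    rw [hact]
    dsimp only
    split_ifs with h1 h2
    · exact h1
    · exact h2.choose_spec
    · exact (h2 (hne a)).elim
  · intro p hp
    refine ⟨fun i => ℓ ((List.range i).map p.state).reverse, rfl, ?_⟩
    intro i hi hinv hav hc
    have hv : ℓ ((List.range (i + 1)).map p.state).reverse = (arena rule M A η).post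
        (μ (p.state i) (ℓ ((List.range i).map p.state).reverse))
        (ℓ ((List.range i).map p.state).reverse) := by
      rw [List.range_succ, List.map_append, List.reverse_append]
      rfl
    have hF : act (p.history i) = fun a : A =>
        μ (p.state i) (ℓ ((List.range i).map p.state).reverse) a := by
      rw [RPath.history_eq, hact]
      funext a
      exact if_pos (hav a)
    obtain ⟨θ, b1, -, -⟩ := Move.complete hinv.1 hav fun r => (hc r).trans (hinv.2 r)
    have hlt := lt_length_of_mem_out hp hi (q' := _) (η' := θ) (by
      change Move rule M A (act (p.history i)) _ _ _ _
      rw [hF]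
      exact b1)
    obtain ⟨σ', c1, c2, c3, -, c5, c6⟩ := Move.sound hinv.1 (hp.1.2.2 i hlt)
    have hsim : (arena rule M A η).sim
        (μ (p.state i) (ℓ ((List.range i).map p.state).reverse)) σ' := fun a ha => by
      rw [← c2 ⟨a, ha⟩]
      exact (congrFun hF ⟨a, ha⟩).symm
    refine ⟨hlt, ⟨c5, fun r => ?_⟩, hv, σ', c1, hsim, c3.symm⟩
    dsimp only
    rw [hv, arena_post_congr hsim]
    exact (Arena.post_mono hinv.2 r).trans (c6 r)

/-! ### The modalities as games -/

/-- Only the first move counts, which the invariant of the opponents refers to by its index. -/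
theorem forall_out_next_iff [Nonempty Act] (X : Q → Prop) :
    (∃ F : Strategy M A, ∀ p ∈ out rule M A F q η, 2 ≤ p.length ∧ X (p.state 1)) ↔
      (arena rule M A η).Force (fun q' _ => X q') q (budget A η) := by
  constructor
  · rintro ⟨F, hF⟩
    by_contra hn
    obtain ⟨p, hp, hp0, hD⟩ := exists_mem_out_of_opponent (rule := rule) (η := η) (q := q) F
      (fun i q' => i = 0 ∧ q' = q)
      (fun i q' w => (i = 0 → w = budget A η) ∧ (i = 1 → ¬ X q')) (by
        rintro i q' w ⟨h1, -⟩ ⟨rfl, rfl⟩ hf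
        rw [h1 rfl] at hf
        exact hn (hf.imp fun q w h => by simpa using h)) (by simp)
    obtain ⟨h1, h2⟩ := hF p hp
    have hlt : ((1 : ℕ) : ℕ∞) < p.length := lt_of_lt_of_le (by norm_num) h1
    exact (hD 1 hlt fun j hj => by
      obtain rfl : j = 0 := by omega
      exact ⟨rfl, hp0⟩).2 rfl h2
  · rintro ⟨m, h1, h2, h3⟩
    obtain ⟨F, hF⟩ := exists_strategy (rule := rule) (M := M) (A := A) (fun _ _ => m) q η
    refine ⟨F, fun p hp => ?_⟩
    obtain ⟨v, hv0, hv⟩ := hF p hp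
    obtain ⟨a1, -, -, σ', a2, a3, a4⟩ := hv 0 p.length_pos
      ⟨fun r => by rw [hp.1.2.1], fun r => by rw [hv0, hp.1.2.1]⟩ (hp.1.1 ▸ h1) (hv0 ▸ h2)
    rw [hp.1.1] at a2 a4
    refine ⟨?_, a4 ▸ h3 σ' a2 a3⟩
    have := Order.add_one_le_of_lt a1
    simpa [one_add_one_eq_two] using this

/-- A strategy that were unsafe for some number `k` of moves would be refuted by opponents who
keep the coalition unsafe for the remaining `k - i` moves. -/
theorem forall_out_always_iff [Nonempty Act] [Finite Agt] [Finite Act] (P : Q → Prop) :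
    (∃ F : Strategy M A, ∀ p ∈ out rule M A F q η, p.length = ⊤ ∧ ∀ i : ℕ, P (p.state i)) ↔
      (arena rule M A η).Safe P q (budget A η) := by
  classical
  constructor
  · rintro ⟨F, hF⟩ k
    by_contra hn
    obtain ⟨p, hp, hp0, hD⟩ := exists_mem_out_of_opponent (rule := rule) (η := η) (q := q) F
      (fun i q' => i < k ∧ P q') (fun i q' w => ¬ (arena rule M A η).SafeFor P (k - i) q' w) (by
        rintro i q' w h1 ⟨h2, h3⟩ hf
        refine h1 ?_
        obtain ⟨l, hl⟩ : ∃ l, k - i = l + 1 := ⟨k - i - 1, by omega⟩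
        rw [show k - (i + 1) = l by omega] at hf
        rw [hl]
        exact ⟨h3, hf.imp fun q w h => not_not.mp h⟩) hn
    obtain ⟨h1, h2⟩ := hF p hp
    have := hD k (by rw [h1]; exact ENat.natCast_lt_top k) fun j hj => ⟨hj, h2 j⟩
    rw [Nat.sub_self] at this
    exact this (h2 k)
  · intro h
    let μ : Q → (Res → ℕ) → Agt → Act := fun q w =>
      if h : (arena rule M A η).Force ((arena rule M A η).Safe P) q w then h.choose
      else fun _ => Classical.arbitrary Act
    have hμ : ∀ {q w}, (arena rule M A η).Safe P q w → (arena rule M A η).avail q (μ q w) ∧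
        (∀ r, (arena rule M A η).cost (μ q w) r ≤ w r) ∧
        ∀ m', (arena rule M A η).avail q m' → (arena rule M A η).sim (μ q w) m' →
          (arena rule M A η).Safe P ((arena rule M A η).succ q m')
            ((arena rule M A η).post (μ q w) w) := by
      intro q w hs
      have hf := (Arena.safe_iff.mp hs).2
      simp only [μ, dif_pos hf]
      exact hf.choose_spec
    obtain ⟨F, hF⟩ := exists_strategy (rule := rule) (M := M) (A := A) μ q η
    refine ⟨F, fun p hp => ?_⟩
    obtain ⟨v, hv0, hv⟩ := hF p hp
    have key : ∀ i : ℕ, (i : ℕ∞) < p.length ∧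
        ((∀ r, total A (p.endow i) r = ⊤ ↔ total A η r = ⊤) ∧
          ∀ r, v i r ≤ budget A (p.endow i) r) ∧
        (arena rule M A η).Safe P (p.state i) (v i) := by
      intro i
      induction i with
      | zero =>
        refine ⟨p.length_pos, ⟨fun r => by rw [hp.1.2.1], fun r => by rw [hv0, hp.1.2.1]⟩, ?_⟩
        rw [hv0, hp.1.1]
        exact h
      | succ i ih =>
        obtain ⟨i1, i2, i3⟩ := ih
        obtain ⟨m1, m2, m3⟩ := hμ i3
        obtain ⟨a1, a2, a3, σ', a4, a5, a6⟩ := hv i i1 i2 m1 m2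
        refine ⟨a1, a2, ?_⟩
        rw [a3, a6]
        exact m3 σ' a4 a5
    refine ⟨?_, fun i => (key i).2.2 0⟩
    by_contra hne
    obtain ⟨n, hn⟩ := ENat.ne_top_iff_exists.mp hne
    have := (key n).1
    rw [← hn] at this
    exact lt_irrefl _ this

/-- A strategy of the coalition is refuted by opponents who stay in its losing positions. -/
theorem forall_out_until_iff [Nonempty Act] [Finite Agt] [Finite Act] (P T : Q → Prop) :
    (∃ F : Strategy M A, ∀ p ∈ out rule M A F q η,
      ∃ i : ℕ, (i : ℕ∞) < p.length ∧ T (p.state i) ∧ ∀ j < i, P (p.state j)) ↔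
      (arena rule M A η).Reach P T q (budget A η) := by
  classical
  constructor
  · rintro ⟨F, hF⟩
    by_contra hn
    obtain ⟨p, hp, hp0, hD⟩ := exists_mem_out_of_opponent (rule := rule) (η := η) (q := q) F
      (fun _ q' => P q') (fun _ q' w => ¬ (arena rule M A η).Reach P T q' w) (by
        rintro i q' w h1 h2 hf
        exact h1 (Arena.reach_iff.mpr (Or.inr ⟨h2, hf.imp fun q w h => not_not.mp h⟩))) hn
    obtain ⟨i, h1, h2, h3⟩ := hF p hp
    exact hD i h1 h3 ⟨0, h2⟩
  · rintro ⟨k, hk⟩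
    -- The coalition plays for the least number of remaining moves.
    let κ : Q → (Res → ℕ) → ℕ := fun q w =>
      sInf {k | (arena rule M A η).Force ((arena rule M A η).ReachIn P T k) q w}
    let μ : Q → (Res → ℕ) → Agt → Act := fun q w =>
      if h : (arena rule M A η).Force ((arena rule M A η).ReachIn P T (κ q w)) q w then h.choose
      else fun _ => Classical.arbitrary Act
    have hμ : ∀ {k q w}, (arena rule M A η).Force ((arena rule M A η).ReachIn P T k) q w →
        (arena rule M A η).avail q (μ q w) ∧
        (∀ r, (arena rule M A η).cost (μ q w) r ≤ w r) ∧
        ∀ m', (arena rule M A η).avail q m' → (arena rule M A η).sim (μ q w) m' →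
          (arena rule M A η).ReachIn P T k ((arena rule M A η).succ q m')
            ((arena rule M A η).post (μ q w) w) := by
      intro k q w hf
      have hle : κ q w ≤ k := Nat.sInf_le hf
      have hκ : (arena rule M A η).Force ((arena rule M A η).ReachIn P T (κ q w)) q w :=
        Nat.sInf_mem (s := {k | (arena rule M A η).Force
          ((arena rule M A η).ReachIn P T k) q w}) ⟨k, hf⟩
      simp only [μ, dif_pos hκ]
      obtain ⟨h1, h2, h3⟩ := hκ.choose_spec
      exact ⟨h1, h2, fun m' a b => (h3 m' a b).le hle⟩
    obtain ⟨F, hF⟩ := exists_strategy (rule := rule) (M := M) (A := A) μ q η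
    refine ⟨F, fun p hp => ?_⟩
    obtain ⟨v, hv0, hv⟩ := hF p hp
    have key : ∀ (k i : ℕ), (i : ℕ∞) < p.length →
        ((∀ r, total A (p.endow i) r = ⊤ ↔ total A η r = ⊤) ∧
          ∀ r, v i r ≤ budget A (p.endow i) r) →
        (arena rule M A η).ReachIn P T k (p.state i) (v i) → (∀ j < i, P (p.state j)) →
        ∃ i : ℕ, (i : ℕ∞) < p.length ∧ T (p.state i) ∧ ∀ j < i, P (p.state j) := by
      intro k
      induction k with
      | zero => exact fun i h1 _ h3 h4 => ⟨i, h1, h3, h4⟩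
      | succ k ih =>
        rintro i h1 h2 (h3 | ⟨h3, h3'⟩) h4
        · exact ⟨i, h1, h3, h4⟩
        · obtain ⟨m1, m2, m3⟩ := hμ h3'
          obtain ⟨a1, a2, a3, σ', a4, a5, a6⟩ := hv i h1 h2 m1 m2
          refine ih (i + 1) a1 a2 ?_ fun j hj => ?_
          · rw [a3, a6]
            exact m3 σ' a4 a5
          · rcases Nat.lt_succ_iff_lt_or_eq.mp hj with hj | rfl
            · exact h4 j hj
            · exact h3
    refine key k 0 p.length_pos ⟨fun r => by rw [hp.1.2.1], fun r => by rw [hv0, hp.1.2.1]⟩ ?_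
      (by simp)
    rw [hv0, hp.1.1]
    exact hk

end Paths

/-! ### Finite certificates for games -/

namespace Arena

variable {Q Mv Res : Type*} (G : Arena Q Mv Res)

/-- `v` bounds `w` strictly from above, where a bound `0` on a resource stands for no bound. -/
def Below (w v : Res → ℕ) : Prop := ∀ r, v r = 0 ∨ w r < v r

open Classical in
/-- The move `m` leads from every position below `v` that affords it to a position below `v'`;
see `Below.post`. -/
def BoundStep (m : Mv) (v v' : Res → ℕ) : Prop :=
  ∀ r, v' r = 0 ∨ (if G.reset m r then G.gain m r < v' r
    else v r ≠ 0 ∧ v r - G.cost m r + G.gain m r ≤ v' r)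

/-- The opponents have an answer in `Y` to every move that is affordable somewhere below `v`. -/
def Foil (Y : Q → Mv → Prop) (q : Q) (v : Res → ℕ) : Prop :=
  ∀ m, G.avail q m → Below (G.cost m) v → ∃ m', G.avail q m' ∧ G.sim m m' ∧ Y (G.succ q m') m

variable {G} {P T : Q → Prop}

theorem Below.post {m : Mv} {w v v' : Res → ℕ} (h : Below w v) (hc : ∀ r, G.cost m r ≤ w r)
    (hs : G.BoundStep m v v') : Below (G.post m w) v' := by
  intro r
  refine (hs r).imp_right fun hr => ?_
  have h1 := h r
  have h2 := hc r
  by_cases h0 : G.reset m r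
  · rw [if_pos h0] at hr
    rwa [post_of_reset h0]
  · rw [if_neg h0] at hr
    rw [post_of_not_reset h0]
    omega

theorem Below.cost_below {m : Mv} {w v : Res → ℕ} (h : Below w v) (hc : ∀ r, G.cost m r ≤ w r) :
    Below (G.cost m) v :=
  fun r => (h r).imp_right fun h => (hc r).trans_lt h

theorem Foil.imp {Y Z : Q → Mv → Prop} (h : ∀ q m, Y q m → Z q m) {q : Q} {v : Res → ℕ}
    (hf : G.Foil Y q v) : G.Foil Z q v := fun m h1 h2 =>
  let ⟨m', a, b, c⟩ := hf m h1 h2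
  ⟨m', a, b, h _ _ c⟩

/-- In the certificates below, an entry `(q, w, k)` claims something about all the positions at
`q` with at least the resources `w`, or with fewer than `w` in the sense of `Below`. The number
`k` makes the justification of an entry by others well-founded where this is needed. -/
abbrev Entries (Q Res : Type*) := Set (Q × (Res → ℕ) × ℕ)

variable {C : Entries Q Res}

theorem reach_of_entries [Finite Mv] (hC : ∀ x ∈ C, T x.1 ∨ P x.1 ∧ G.Force
      (fun q w => ∃ y ∈ C, y.1 = q ∧ y.2.2 < x.2.2 ∧ ∀ r, y.2.1 r ≤ w r) x.1 x.2.1) :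
    ∀ x ∈ C, G.Reach P T x.1 x.2.1 := by
  intro x
  induction hk : x.2.2 using Nat.strong_induction_on generalizing x with
  | _ k ih =>
    intro hx
    refine reach_iff.mpr ((hC x hx).imp_right fun h => ⟨h.1, h.2.imp ?_⟩)
    rintro q w ⟨y, hy, rfl, hlt, hle⟩
    exact (ih _ (hk ▸ hlt) y rfl hy).mono hle

/-- No rank is needed here, since the coalition only has to avoid leaving `P`. -/
theorem safe_of_entries (hC : ∀ x ∈ C, P x.1 ∧ G.Force
      (fun q w => ∃ y ∈ C, y.1 = q ∧ ∀ r, y.2.1 r ≤ w r) x.1 x.2.1) :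
    ∀ x ∈ C, G.Safe P x.1 x.2.1 := by
  intro x hx k
  induction k generalizing x with
  | zero => exact (hC x hx).1
  | succ k ih =>
    refine ⟨(hC x hx).1, (hC x hx).2.imp ?_⟩
    rintro q w ⟨y, hy, rfl, hle⟩
    exact (ih y hy).mono hle

/-- No rank is needed here, since the opponents only have to avoid `T` forever. -/
theorem not_reach_of_entries (hC : ∀ x ∈ C, ¬ T x.1 ∧ (¬ P x.1 ∨ G.Foil
      (fun q m => ∃ y ∈ C, y.1 = q ∧ G.BoundStep m x.2.1 y.2.1) x.1 x.2.1)) :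
    ∀ x ∈ C, ∀ w, Below w x.2.1 → ¬ G.Reach P T x.1 w := by
  rintro x hx w hw ⟨k, hk⟩
  induction k generalizing x w with
  | zero => exact (hC x hx).1 hk
  | succ k ih =>
    rcases hk with hk | ⟨hP, m, h1, h2, h3⟩
    · exact (hC x hx).1 hk
    · rcases (hC x hx).2 with h | h
      · exact h hP
      · obtain ⟨m', a, b, y, hy, hyq, hyb⟩ := h m h1 (hw.cost_below h2)
        have := h3 m' a b
        rw [← hyq] at this
        exact ih y hy _ (hw.post h2 hyb) this

theorem not_safe_of_entries [Finite Mv] (hC : ∀ x ∈ C, ¬ P x.1 ∨ G.Foil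
      (fun q m => ∃ y ∈ C, y.1 = q ∧ y.2.2 < x.2.2 ∧ G.BoundStep m x.2.1 y.2.1) x.1 x.2.1) :
    ∀ x ∈ C, ∀ w, Below w x.2.1 → ¬ G.Safe P x.1 w := by
  intro x
  induction hk : x.2.2 using Nat.strong_induction_on generalizing x with
  | _ k ih =>
    intro hx w hw hs
    obtain ⟨hP, m, h1, h2, h3⟩ := safe_iff.mp hs
    rcases hC x hx with h | h
    · exact h hP
    · obtain ⟨m', a, b, y, hy, hyq, hlt, hyb⟩ := h m h1 (hw.cost_below h2)
      have := h3 m' a b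
      rw [← hyq] at this
      exact ih _ (hk ▸ hlt) y rfl hy _ (hw.post h2 hyb) this

/-- The entries are the positions of a finite tree of plays, ranked by the remaining moves. -/
theorem exists_entries_of_reachIn [Finite Mv] (k : ℕ) (q : Q) (w : Res → ℕ)
    (h : G.ReachIn P T k q w) :
    ∃ C : Entries Q Res, C.Finite ∧ (q, w, k) ∈ C ∧ ∀ x ∈ C, T x.1 ∨ P x.1 ∧ G.Force
      (fun q w => ∃ y ∈ C, y.1 = q ∧ y.2.2 < x.2.2 ∧ ∀ r, y.2.1 r ≤ w r) x.1 x.2.1 := by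
  induction k generalizing q w with
  | zero =>
    refine ⟨{(q, w, 0)}, Set.finite_singleton _, rfl, ?_⟩
    rintro _ rfl
    exact Or.inl h
  | succ k ih =>
    rcases h with h | ⟨hP, m, h1, h2, h3⟩
    · refine ⟨{(q, w, k + 1)}, Set.finite_singleton _, rfl, ?_⟩
      rintro _ rfl
      exact Or.inl h
    · have H : ∀ m' : Mv, ∃ C : Entries Q Res, C.Finite ∧
          (G.avail q m' → G.sim m m' → (G.succ q m', G.post m w, k) ∈ C) ∧
          ∀ x ∈ C, T x.1 ∨ P x.1 ∧ G.Force
            (fun q w => ∃ y ∈ C, y.1 = q ∧ y.2.2 < x.2.2 ∧ ∀ r, y.2.1 r ≤ w r) x.1 x.2.1 := by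
        intro m'
        by_cases hm : G.avail q m' ∧ G.sim m m'
        · obtain ⟨C, c1, c2, c3⟩ := ih _ _ (h3 m' hm.1 hm.2)
          exact ⟨C, c1, fun _ _ => c2, c3⟩
        · exact ⟨∅, Set.finite_empty, fun a b => (hm ⟨a, b⟩).elim, by simp⟩
      choose C c1 c2 c3 using H
      refine ⟨insert (q, w, k + 1) (⋃ m', C m'), (Set.finite_iUnion c1).insert _,
        Set.mem_insert _ _, ?_⟩
      rintro x (rfl | hx)
      · exact Or.inr ⟨hP, m, h1, h2, fun m' a b => ⟨_, Set.mem_insert_of_mem _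
          (Set.mem_iUnion.mpr ⟨m', c2 m' a b⟩), rfl, Nat.lt_succ_self k, fun _ => le_rfl⟩⟩
      · obtain ⟨m', hm'⟩ := Set.mem_iUnion.mp hx
        refine (c3 m' x hm').imp_right fun h => ⟨h.1, h.2.imp ?_⟩
        rintro q' w' ⟨y, hy, hy'⟩
        exact ⟨y, Set.mem_insert_of_mem _ (Set.mem_iUnion.mpr ⟨m', hy⟩), hy'⟩

/-- The entries are the positions of a finite tree of plays, one answer of the opponents being
chosen for each move of the coalition. -/
theorem exists_entries_of_not_safeFor [Finite Mv] (k : ℕ) (q : Q) (w : Res → ℕ)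
    (h : ¬ G.SafeFor P k q w) :
    ∃ C : Entries Q Res, C.Finite ∧ (q, (fun r => w r + 1), k) ∈ C ∧ ∀ x ∈ C, ¬ P x.1 ∨ G.Foil
      (fun q m => ∃ y ∈ C, y.1 = q ∧ y.2.2 < x.2.2 ∧ G.BoundStep m x.2.1 y.2.1) x.1 x.2.1 := by
  induction k generalizing q w with
  | zero =>
    refine ⟨{(q, (fun r => w r + 1), 0)}, Set.finite_singleton _, rfl, ?_⟩
    rintro _ rfl
    exact Or.inl h
  | succ k ih =>
    by_cases hP : P q
    · have hF : ¬ G.Force (G.SafeFor P k) q w := fun hF => h ⟨hP, hF⟩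
      have H : ∀ m : Mv, ∃ C : Entries Q Res, C.Finite ∧
          (G.avail q m → (∀ r, G.cost m r ≤ w r) → ∃ m', G.avail q m' ∧ G.sim m m' ∧
            (G.succ q m', (fun r => G.post m w r + 1), k) ∈ C) ∧
          ∀ x ∈ C, ¬ P x.1 ∨ G.Foil (fun q m => ∃ y ∈ C, y.1 = q ∧ y.2.2 < x.2.2 ∧
            G.BoundStep m x.2.1 y.2.1) x.1 x.2.1 := by
        intro m
        by_cases hm : G.avail q m ∧ ∀ r, G.cost m r ≤ w r
        · obtain ⟨m', a, b, c⟩ := not_force hF hm.1 hm.2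
          obtain ⟨C, c1, c2, c3⟩ := ih _ _ c
          exact ⟨C, c1, fun _ _ => ⟨m', a, b, c2⟩, c3⟩
        · exact ⟨∅, Set.finite_empty, fun a b => (hm ⟨a, b⟩).elim, by simp⟩
      choose C c1 c2 c3 using H
      refine ⟨insert (q, (fun r => w r + 1), k + 1) (⋃ m, C m), (Set.finite_iUnion c1).insert _,
        Set.mem_insert _ _, ?_⟩
      rintro x (rfl | hx)
      · refine Or.inr fun m h1 h2 => ?_
        have h2' : ∀ r, G.cost m r ≤ w r := fun r => by
          have := h2 r
          dsimp only at this
          omega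
        obtain ⟨m', a, b, hmem⟩ := c2 m h1 h2'
        refine ⟨m', a, b, _, Set.mem_insert_of_mem _ (Set.mem_iUnion.mpr ⟨m, hmem⟩), rfl,
          Nat.lt_succ_self k, fun r => Or.inr ?_⟩
        have := h2' r
        by_cases h0 : G.reset m r
        · simp only [h0, if_true, post_of_reset h0]
          omega
        · simp only [h0, if_false, post_of_not_reset h0]
          omega
      · obtain ⟨m, hm⟩ := Set.mem_iUnion.mp hx
        refine (c3 m x hm).imp_right fun h => h.imp ?_
        rintro q' m' ⟨y, hy, hy'⟩
        exact ⟨y, Set.mem_insert_of_mem _ (Set.mem_iUnion.mpr ⟨m, hy⟩), hy'⟩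
    · refine ⟨{(q, (fun r => w r + 1), k + 1)}, Set.finite_singleton _, rfl, ?_⟩
      rintro _ rfl
      exact Or.inl hP

/-- Dickson's lemma: every set of positions contains a finite set of positions one of which lies
below any given position of the set. -/
theorem exists_finite_basis [Finite Q] [Finite Res] (U : Q → (Res → ℕ) → Prop) :
    ∃ B : Set (Q × (Res → ℕ)), B.Finite ∧ (∀ x ∈ B, U x.1 x.2) ∧
      ∀ q w, U q w → ∃ u, (q, u) ∈ B ∧ ∀ r, u r ≤ w r := by
  refine ⟨⋃ q, (fun u => (q, u)) '' {u | Minimal (U q) u}, ?_, ?_, ?_⟩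
  · refine Set.finite_iUnion fun q => Set.Finite.image _ ?_
    exact WellQuasiOrderedLE.finite_of_isAntichain (setOfPred_minimal_antichain (U q))
  · intro x hx
    obtain ⟨q, u, hu, rfl⟩ := Set.mem_iUnion.mp hx
    exact hu.prop
  · intro q w hw
    obtain ⟨u, hle, hu⟩ := exists_minimal_le_of_wellFoundedLT (U q) w hw
    exact ⟨u, Set.mem_iUnion.mpr ⟨q, u, hu, rfl⟩, hle⟩

/-- The entries are the minimal winning positions. -/
theorem exists_entries_of_safe [Finite Q] [Finite Mv] [Finite Res] (q : Q) (w : Res → ℕ)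
    (h : G.Safe P q w) :
    ∃ C : Entries Q Res, C.Finite ∧ (∃ x ∈ C, x.1 = q ∧ ∀ r, x.2.1 r ≤ w r) ∧
      ∀ x ∈ C, P x.1 ∧ G.Force (fun q w => ∃ y ∈ C, y.1 = q ∧ ∀ r, y.2.1 r ≤ w r) x.1 x.2.1 := by
  obtain ⟨B, hB, hBU, hUB⟩ := exists_finite_basis (G.Safe P)
  have hmem : ∀ q w, G.Safe P q w →
      ∃ y ∈ (fun x : Q × (Res → ℕ) => (x.1, x.2, 0)) '' B, y.1 = q ∧ ∀ r, y.2.1 r ≤ w r := by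
    intro q w h
    obtain ⟨u, hu, hle⟩ := hUB q w h
    exact ⟨_, ⟨_, hu, rfl⟩, rfl, hle⟩
  refine ⟨_, hB.image _, hmem q w h, ?_⟩
  rintro _ ⟨x, hx, rfl⟩
  obtain ⟨h1, h2⟩ := safe_iff.mp (hBU x hx)
  exact ⟨h1, h2.imp hmem⟩

/-- The winning positions are an upward closed set, hence determined by what happens below some
`B`. The entries describe its complement, where resources from `B` on are replaced by
infinity. -/
theorem exists_entries_of_not_reach [Finite Q] [Finite Mv] [Finite Res] (q : Q) (w : Res → ℕ)
    (h : ¬ G.Reach P T q w) :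
    ∃ C : Entries Q Res, C.Finite ∧ (∃ x ∈ C, x.1 = q ∧ Below w x.2.1) ∧
      ∀ x ∈ C, ¬ T x.1 ∧ (¬ P x.1 ∨ G.Foil
        (fun q m => ∃ y ∈ C, y.1 = q ∧ G.BoundStep m x.2.1 y.2.1) x.1 x.2.1) := by
  obtain ⟨S, hS, hSU, hUS⟩ := exists_finite_basis (G.Reach P T)
  obtain ⟨B, hB⟩ : ∃ B : ℕ, ∀ x ∈ S, ∀ r, x.2 r ≤ B := by
    have : (⋃ r, (fun x : Q × (Res → ℕ) => x.2 r) '' S).Finite :=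
      Set.finite_iUnion fun r => hS.image _
    obtain ⟨B, hB⟩ := this.bddAbove
    exact ⟨B, fun x hx r => hB (Set.mem_iUnion.mpr ⟨r, x, hx, rfl⟩)⟩
  obtain ⟨c, hc⟩ := Finite.exists_le fun x : Mv × Res => G.cost x.1 x.2
  -- Amounts from `B` on are indistinguishable.
  have hcap : ∀ q (w w' : Res → ℕ), (∀ r, w' r < B → w r ≤ w' r) → G.Reach P T q w →
      G.Reach P T q w' := by
    intro q w w' hle hw
    obtain ⟨u, hu, huw⟩ := hUS q w hw
    refine (hSU _ hu).mono fun r => ?_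
    have h1 := hB _ hu r
    have h2 := huw r
    have h3 := hle r
    dsimp only at h1 ⊢
    omega
  -- A position below the bound `v` that is large enough to stand for all of them.
  let top : (Res → ℕ) → Res → ℕ := fun v r => if v r = 0 then B + c else v r - 1
  let ceil : (Res → ℕ) → Res → ℕ := fun w r => if w r < B then w r + 1 else 0
  have hceil : ∀ q w, ¬ G.Reach P T q w → ¬ G.Reach P T q (top (ceil w)) := by
    intro q w hw hr
    refine hw (hcap q _ _ (fun r hr => ?_) hr)
    simp [top, ceil, hr]
  let C : Entries Q Res := {x | x.2.2 = 0 ∧ (∀ r, x.2.1 r ≤ B) ∧ ¬ G.Reach P T x.1 (top x.2.1)}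
  have hmem : ∀ q w, ¬ G.Reach P T q w → (q, ceil w, 0) ∈ C := by
    refine fun q w hw => ⟨rfl, fun r => ?_, hceil q w hw⟩
    dsimp only [ceil]
    split_ifs <;> omega
  refine ⟨C, ?_, ⟨_, hmem q w h, rfl, fun r => ?_⟩, ?_⟩
  · refine Set.Finite.subset ((Set.finite_univ (α := Q)).prod
      ((Set.Finite.pi' fun _ : Res => Set.finite_Iic B).prod (Set.finite_singleton 0))) ?_
    rintro x ⟨h1, h2, -⟩
    exact ⟨trivial, h2, h1⟩
  · dsimp only [ceil]
    split_ifs <;> omega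
  · rintro ⟨p, v, k⟩ ⟨-, hv, hx⟩
    dsimp only at hv hx ⊢
    rw [reach_iff, not_or, not_and_or] at hx
    refine ⟨hx.1, hx.2.imp_right fun hF m h1 h2 => ?_⟩
    have hcost : ∀ r, G.cost m r ≤ top v r := by
      intro r
      have a1 := h2 r
      have a2 := hc (m, r)
      dsimp only [top] at a2 ⊢
      split_ifs <;> omega
    obtain ⟨m', a, b, hn⟩ := not_force hF h1 hcost
    refine ⟨m', a, b, _, hmem _ _ hn, rfl, fun r => ?_⟩
    have a1 := h2 r
    have a2 := hc (m, r)
    have a3 := hcost r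
    dsimp only [ceil] at a2 ⊢
    by_cases hlt : G.post m (top v) r < B
    · right
      rw [if_pos hlt]
      by_cases h0 : G.reset m r
      · rw [if_pos h0, post_of_reset h0]
        omega
      · rw [if_neg h0]
        rw [post_of_not_reset h0] at hlt ⊢
        dsimp only [top] at hlt a3 ⊢
        split_ifs at hlt a3 ⊢ with h3
        · omega
        · omega
    · left
      rw [if_neg hlt]

end Arena

/-! ### Primitive recursive programs -/

section Programs

attribute [local fun_prop] Primrec Primrec.id Primrec.const Primrec.comp Primrec.pair

variable {α β γ : Type*} [Primcodable α] [Primcodable β] [Primcodable γ]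

/-- Whether `p x` holds for all `x < n`. -/
def allLt (n : ℕ) (p : ℕ → Bool) : Bool := (List.range n).all p

/-- Whether `p x` holds for some `x < n`. -/
def anyLt (n : ℕ) (p : ℕ → Bool) : Bool := (List.range n).any p

/-- The sum of `f x` over `x < n`. -/
def sumLt (n : ℕ) (f : ℕ → ℕ) : ℕ := ((List.range n).map f).sum

@[local fun_prop]
theorem primrec_fst {f : α → β × γ} (hf : Primrec f) : Primrec fun x => (f x).1 :=
  Primrec.fst.comp hf

@[local fun_prop]
theorem primrec_snd {f : α → β × γ} (hf : Primrec f) : Primrec fun x => (f x).2 :=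
  Primrec.snd.comp hf

@[local fun_prop]
theorem primrec_add {f g : α → ℕ} (hf : Primrec f) (hg : Primrec g) :
    Primrec fun x => f x + g x := Primrec.nat_add.comp hf hg

@[local fun_prop]
theorem primrec_sub {f g : α → ℕ} (hf : Primrec f) (hg : Primrec g) :
    Primrec fun x => f x - g x := Primrec.nat_sub.comp hf hg

@[local fun_prop]
theorem primrec_div {f g : α → ℕ} (hf : Primrec f) (hg : Primrec g) :
    Primrec fun x => f x / g x := Primrec.nat_div.comp hf hg

@[local fun_prop]
theorem primrec_mod {f g : α → ℕ} (hf : Primrec f) (hg : Primrec g) :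
    Primrec fun x => f x % g x := Primrec.nat_mod.comp hf hg

@[local fun_prop]
theorem primrec_pow {f g : α → ℕ} (hf : Primrec f) (hg : Primrec g) :
    Primrec fun x => f x ^ g x := by
  have : Primrec₂ ((· ^ ·) : ℕ → ℕ → ℕ) := Primrec₂.unpaired'.1 Nat.Primrec.pow
  exact this.comp hf hg

@[local fun_prop]
theorem primrec_beq [DecidableEq β] {f g : α → β} (hf : Primrec f) (hg : Primrec g) :
    Primrec fun x => f x == g x := Primrec.beq.comp hf hg

@[local fun_prop]
theorem primrec_ble {f g : α → ℕ} (hf : Primrec f) (hg : Primrec g) :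
    Primrec fun x => Nat.ble (f x) (g x) :=
  (Primrec.nat_le.decide.comp hf hg).of_eq fun x => by
    rw [Bool.eq_iff_iff, decide_eq_true_iff, Nat.ble_eq]

@[local fun_prop]
theorem primrec_blt {f g : α → ℕ} (hf : Primrec f) (hg : Primrec g) :
    Primrec fun x => Nat.blt (f x) (g x) :=
  (Primrec.nat_lt.decide.comp hf hg).of_eq fun x => by
    rw [Bool.eq_iff_iff, decide_eq_true_iff, Nat.blt_eq]

@[local fun_prop]
theorem primrec_and {f g : α → Bool} (hf : Primrec f) (hg : Primrec g) :
    Primrec fun x => f x && g x := Primrec.and.comp hf hg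

@[local fun_prop]
theorem primrec_or {f g : α → Bool} (hf : Primrec f) (hg : Primrec g) :
    Primrec fun x => f x || g x := Primrec.or.comp hf hg

@[local fun_prop]
theorem primrec_not {f : α → Bool} (hf : Primrec f) : Primrec fun x => !f x := Primrec.not.comp hf

@[local fun_prop]
theorem primrec_cond {c : α → Bool} {f g : α → β} (hc : Primrec c) (hf : Primrec f)
    (hg : Primrec g) : Primrec fun x => cond (c x) (f x) (g x) := Primrec.cond hc hf hg

@[local fun_prop]
theorem primrec_getD {f : α → List β} {g : α → ℕ} (d : β) (hf : Primrec f) (hg : Primrec g) :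
    Primrec fun x => (f x).getD (g x) d := (Primrec.list_getD d).comp hf hg

@[local fun_prop]
theorem primrec_length {f : α → List β} (hf : Primrec f) :
    Primrec fun x => (f x).length := Primrec.list_length.comp hf

@[local fun_prop]
theorem primrec_option_getD {f : α → Option β} {g : α → β} (hf : Primrec f) (hg : Primrec g) :
    Primrec fun x => (f x).getD (g x) := Primrec.option_getD.comp hf hg

@[local fun_prop]
theorem primrec_isSome {f : α → Option β} (hf : Primrec f) :
    Primrec fun x => (f x).isSome := Primrec.option_isSome.comp hf

@[local fun_prop]
theorem primrec_unpair {f : α → ℕ} (hf : Primrec f) :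
    Primrec fun x => (f x).unpair := Primrec.unpair.comp hf

@[local fun_prop]
theorem primrec_encode {f : α → β} (hf : Primrec f) :
    Primrec fun x => Encodable.encode (f x) := Primrec.encode.comp hf

@[local fun_prop]
theorem primrec_decode {f : α → ℕ} (hf : Primrec f) :
    Primrec fun x => (Encodable.decode (f x) : Option β) := Primrec.decode.comp hf

@[local fun_prop]
theorem primrec_all {f : α → List β} {p : α → β → Bool} (hf : Primrec f)
    (hp : Primrec fun x : α × β => p x.1 x.2) : Primrec fun x => (f x).all (p x) :=
  (Primrec.list_foldr hf (Primrec.const true) (h := fun x y => p x y.1 && y.2)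
    (Primrec.and.comp (hp.comp (Primrec.pair Primrec.fst (Primrec.fst.comp Primrec.snd)))
      (Primrec.snd.comp Primrec.snd))).of_eq fun x => by
    induction f x with
    | nil => rfl
    | cons a l ih => simp [ih]

@[local fun_prop]
theorem primrec_any {f : α → List β} {p : α → β → Bool} (hf : Primrec f)
    (hp : Primrec fun x : α × β => p x.1 x.2) : Primrec fun x => (f x).any (p x) :=
  (Primrec.list_foldr hf (Primrec.const false) (h := fun x y => p x y.1 || y.2)
    (Primrec.or.comp (hp.comp (Primrec.pair Primrec.fst (Primrec.fst.comp Primrec.snd)))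
      (Primrec.snd.comp Primrec.snd))).of_eq fun x => by
    induction f x with
    | nil => rfl
    | cons a l ih => simp [ih]

@[local fun_prop]
theorem primrec_allLt {f : α → ℕ} {p : α → ℕ → Bool} (hf : Primrec f)
    (hp : Primrec fun x : α × ℕ => p x.1 x.2) : Primrec fun x => allLt (f x) (p x) :=
  primrec_all (Primrec.list_range.comp hf) hp

@[local fun_prop]
theorem primrec_anyLt {f : α → ℕ} {p : α → ℕ → Bool} (hf : Primrec f)
    (hp : Primrec fun x : α × ℕ => p x.1 x.2) : Primrec fun x => anyLt (f x) (p x) :=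
  primrec_any (Primrec.list_range.comp hf) hp

@[local fun_prop]
theorem primrec_sumLt {f : α → ℕ} {g : α → ℕ → ℕ} (hf : Primrec f)
    (hg : Primrec fun x : α × ℕ => g x.1 x.2) : Primrec fun x => sumLt (f x) (g x) :=
  (Primrec.list_foldr (Primrec.list_range.comp hf) (Primrec.const 0) (h := fun x y => g x y.1 + y.2)
    (Primrec.nat_add.comp (hg.comp (Primrec.pair Primrec.fst (Primrec.fst.comp Primrec.snd)))
      (Primrec.snd.comp Primrec.snd))).of_eq fun x => by
    unfold sumLt
    induction List.range (f x) with
    | nil => rfl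
    | cons a l ih => simp [ih]

/-! ### The checker -/

namespace Code

/-- Whether a proposition is true at a state. -/
def val (c : Code) (q p : ℕ) : Bool := (c.2.1.getD q []).getD p false

/-- Whether an action is available to an agent at a state. -/
def avail (c : Code) (a q α : ℕ) : Bool := ((c.2.2.1.getD a []).getD q []).getD α false

/-- The successor of a state under a joint action. -/
def step (c : Code) (q s : ℕ) : ℕ := (c.2.2.2.1.getD q []).getD s 0

/-- The effect of an action on a resource, as sign and absolute value. -/
def effect (c : Code) (α r : ℕ) : Bool × ℕ := (c.2.2.2.2.1.getD α []).getD r (false, 0)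

/-- The number of joint actions. -/
def moves (c : Code) : ℕ := c.1.2.2.2.1 ^ c.1.1

/-- The action of the agent `a` in the joint action number `s`. -/
def act (c : Code) (s a : ℕ) : ℕ := s / c.1.2.2.2.1 ^ a % c.1.2.2.2.1

/-- Whether a joint action is available at a state. -/
def joint (c : Code) (q s : ℕ) : Bool := allLt c.1.1 fun a => avail c a q (act c s a)

/-- The coalition and the endowment with the code `d`. -/
def coalition (d : ℕ) : List Bool × List (List (Option ℕ)) := (Encodable.decode d).getD ([], [])

/-- Whether an agent belongs to the coalition. -/
def mem (d a : ℕ) : Bool := (coalition d).1.getD a false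

/-- What an agent owns of a resource, with `none` for `∞`. -/
def endow (d a r : ℕ) : Option ℕ := ((coalition d).2.getD a []).getD r none

/-- Whether some member of the coalition owns infinitely much of a resource. -/
def unbounded (c : Code) (d r : ℕ) : Bool :=
  anyLt c.1.1 fun a => mem d a && !(endow d a r).isSome

/-- The sum of `f` over the coalition, and `0` for an unbounded resource. -/
def coalitionSum (c : Code) (d r : ℕ) (f : ℕ → ℕ) : ℕ :=
  cond (unbounded c d r) 0 (sumLt c.1.1 fun a => cond (mem d a) (f a) 0)

/-- What the coalition owns of a resource. -/
def budget (c : Code) (d r : ℕ) : ℕ := coalitionSum c d r fun a => (endow d a r).getD 0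

/-- What a joint action costs the coalition. -/
def cost (c : Code) (d s r : ℕ) : ℕ := coalitionSum c d r fun a =>
  cond (effect c (act c s a) r).1 (effect c (act c s a) r).2 0

/-- What the coalition gains from a joint action. -/
def gain (c : Code) (d s r : ℕ) : ℕ := coalitionSum c d r fun a =>
  cond (effect c (act c s a) r).1 0 (effect c (act c s a) r).2

/-- Whether two joint actions agree on the coalition. -/
def sim (c : Code) (d s s' : ℕ) : Bool :=
  allLt c.1.1 fun a => !mem d a || act c s a == act c s' a

/-- Whether a joint action forfeits a resource. -/
def reset (lax : Bool) (c : Code) (d s r : ℕ) : Bool := lax && cost c d s r == 0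

/-- What is left of a resource after a joint action. -/
def post (lax : Bool) (c : Code) (d s : ℕ) (w : List ℕ) (r : ℕ) : ℕ :=
  cond (reset lax c d s r) (gain c d s r) (w.getD r 0 - cost c d s r + gain c d s r)

/-- An entry `(f, q, b, w, k)` of a certificate claims that the formula with code `f` has the truth
value `b` at `q`. For a modality the claim is about the game of the formula: the coalition wins from
`q` with at least the resources `w` if `b` is true, and it loses from `q` with fewer than `w`
resources if `b` is false, where a bound `0` stands for no bound. The number `k` is the rank of the
entry among the entries for the same formula. -/
abbrev Entry := ℕ × ℕ × Bool × List ℕ × ℕ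

/-- The leading symbol of the formula of an entry. -/
def tag (e : Entry) : ℕ := e.1.unpair.1

/-- The code of the coalition and the endowment of a modality. -/
def data (e : Entry) : ℕ := e.1.unpair.2.unpair.1

/-- Whether the claim of an entry covers the position at which the game of its formula starts. -/
def covers (c : Code) (e : Entry) : Bool :=
  Nat.blt (tag e) 3 || allLt c.1.2.2.2.2 fun r =>
    cond e.2.2.1 (Nat.ble (e.2.2.2.1.getD r 0) (budget c (data e) r))
      (e.2.2.2.1.getD r 0 == 0 || Nat.blt (budget c (data e) r) (e.2.2.2.1.getD r 0))

/-- Whether the list claims that the formula with code `g` has the truth value `b` at `q`. -/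
def claims (c : Code) (L : List Entry) (g q : ℕ) (b : Bool) : Bool :=
  L.any fun y => (y.1 == g && y.2.1 == q) && (y.2.2.1 == b && covers c y)

/-- Whether the coalition wins the game of `e` once the joint action `s` has led to `q`. -/
def hits (lax : Bool) (c : Code) (L : List Entry) (e : Entry) (s q : ℕ) : Bool :=
  cond (tag e == 3) (claims c L e.1.unpair.2.unpair.2 q true)
    (L.any fun y => (y.1 == e.1 && y.2.1 == q) && (y.2.2.1 &&
        (tag e == 4 || Nat.blt y.2.2.2.2 e.2.2.2.2)) &&
      allLt c.1.2.2.2.2 fun r => Nat.ble (y.2.2.2.1.getD r 0) (post lax c (data e) s e.2.2.2.1 r))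

/-- Whether the coalition has a winning move in the game of `e`. -/
def force (lax : Bool) (c : Code) (L : List Entry) (e : Entry) : Bool :=
  anyLt (moves c) fun s => (joint c e.2.1 s &&
    allLt c.1.2.2.2.2 fun r => Nat.ble (cost c (data e) s r) (e.2.2.2.1.getD r 0)) &&
    allLt (moves c) fun s' => !joint c e.2.1 s' || (!sim c (data e) s s' ||
      hits lax c L e s (step c e.2.1 s'))

/-- Whether the coalition loses the game of `e` once the joint action `s` has led to `q`. -/
def misses (lax : Bool) (c : Code) (L : List Entry) (e : Entry) (s q : ℕ) : Bool :=
  cond (tag e == 3) (claims c L e.1.unpair.2.unpair.2 q false)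
    (L.any fun y => (y.1 == e.1 && y.2.1 == q) && (!y.2.2.1 &&
        (tag e == 5 || Nat.blt y.2.2.2.2 e.2.2.2.2)) &&
      allLt c.1.2.2.2.2 fun r => y.2.2.2.1.getD r 0 == 0 ||
        cond (reset lax c (data e) s r) (Nat.blt (gain c (data e) s r) (y.2.2.2.1.getD r 0))
          (!(e.2.2.2.1.getD r 0 == 0) && Nat.ble
            (e.2.2.2.1.getD r 0 - cost c (data e) s r + gain c (data e) s r) (y.2.2.2.1.getD r 0)))

/-- Whether the opponents have an answer to all moves of the coalition in the game of `e`. -/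
def foil (lax : Bool) (c : Code) (L : List Entry) (e : Entry) : Bool :=
  allLt (moves c) fun s => (!joint c e.2.1 s || !allLt c.1.2.2.2.2 fun r =>
      e.2.2.2.1.getD r 0 == 0 || Nat.blt (cost c (data e) s r) (e.2.2.2.1.getD r 0)) ||
    anyLt (moves c) fun s' => joint c e.2.1 s' && (sim c (data e) s s' &&
      misses lax c L e s (step c e.2.1 s'))

/-- Whether the claim of `e` follows from the claims of the entries in `L`. -/
def justified (lax : Bool) (c : Code) (L : List Entry) (e : Entry) : Bool :=
  cond (tag e == 0) (e.2.2.1 == val c e.2.1 e.1.unpair.2) <|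
  cond (tag e == 1) (claims c L e.1.unpair.2 e.2.1 (!e.2.2.1)) <|
  cond (tag e == 2) (cond e.2.2.1
    (claims c L e.1.unpair.2.unpair.1 e.2.1 true && claims c L e.1.unpair.2.unpair.2 e.2.1 true)
    (claims c L e.1.unpair.2.unpair.1 e.2.1 false ||
      claims c L e.1.unpair.2.unpair.2 e.2.1 false)) <|
  cond (tag e == 3) (cond e.2.2.1 (force lax c L e) (foil lax c L e)) <|
  cond (tag e == 4) (cond e.2.2.1
    (claims c L e.1.unpair.2.unpair.2 e.2.1 true && force lax c L e)
    (claims c L e.1.unpair.2.unpair.2 e.2.1 false || foil lax c L e)) <|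
  cond e.2.2.1
    (claims c L e.1.unpair.2.unpair.2.unpair.2 e.2.1 true ||
      (claims c L e.1.unpair.2.unpair.2.unpair.1 e.2.1 true && force lax c L e))
    (claims c L e.1.unpair.2.unpair.2.unpair.2 e.2.1 false &&
      (claims c L e.1.unpair.2.unpair.2.unpair.1 e.2.1 false || foil lax c L e))

/-- Whether `L` is a certificate: all its claims follow from each other. -/
def check (lax : Bool) (c : Code) (L : List Entry) : Bool := L.all (justified lax c L)

section

variable {c : α → Code} {L : α → List Entry} {e : α → Entry} {b : α → Bool}
  {d q r s t w f g : α → ℕ} (lax : Bool)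

@[local fun_prop]
theorem primrec_val (hc : Primrec c) (hq : Primrec q) (hr : Primrec r) :
    Primrec fun x => val (c x) (q x) (r x) := by unfold val; fun_prop

@[local fun_prop]
theorem primrec_avail (hc : Primrec c) (hd : Primrec d) (hq : Primrec q) (hr : Primrec r) :
    Primrec fun x => avail (c x) (d x) (q x) (r x) := by unfold avail; fun_prop

@[local fun_prop]
theorem primrec_step (hc : Primrec c) (hq : Primrec q) (hr : Primrec r) :
    Primrec fun x => step (c x) (q x) (r x) := by unfold step; fun_prop

@[local fun_prop]
theorem primrec_effect (hc : Primrec c) (hq : Primrec q) (hr : Primrec r) :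
    Primrec fun x => effect (c x) (q x) (r x) := by unfold effect; fun_prop

@[local fun_prop]
theorem primrec_moves (hc : Primrec c) : Primrec fun x => moves (c x) := by unfold moves; fun_prop

@[local fun_prop]
theorem primrec_act (hc : Primrec c) (hq : Primrec q) (hr : Primrec r) :
    Primrec fun x => act (c x) (q x) (r x) := by unfold act; fun_prop

@[local fun_prop]
theorem primrec_joint (hc : Primrec c) (hq : Primrec q) (hr : Primrec r) :
    Primrec fun x => joint (c x) (q x) (r x) := by unfold joint; fun_prop

@[local fun_prop]
theorem primrec_coalition (hd : Primrec d) : Primrec fun x => coalition (d x) := by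
  unfold coalition; fun_prop

@[local fun_prop]
theorem primrec_mem (hd : Primrec d) (hq : Primrec q) : Primrec fun x => mem (d x) (q x) := by
  unfold mem; fun_prop

@[local fun_prop]
theorem primrec_endow (hd : Primrec d) (hq : Primrec q) (hr : Primrec r) :
    Primrec fun x => endow (d x) (q x) (r x) := by unfold endow; fun_prop

@[local fun_prop]
theorem primrec_unbounded (hc : Primrec c) (hd : Primrec d) (hr : Primrec r) :
    Primrec fun x => unbounded (c x) (d x) (r x) := by unfold unbounded; fun_prop

@[local fun_prop]
theorem primrec_coalitionSum {f : α → ℕ → ℕ} (hc : Primrec c) (hd : Primrec d) (hr : Primrec r)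
    (hf : Primrec fun x : α × ℕ => f x.1 x.2) :
    Primrec fun x => coalitionSum (c x) (d x) (r x) (f x) := by unfold coalitionSum; fun_prop

@[local fun_prop]
theorem primrec_budget (hc : Primrec c) (hd : Primrec d) (hr : Primrec r) :
    Primrec fun x => budget (c x) (d x) (r x) := by unfold budget; fun_prop

@[local fun_prop]
theorem primrec_cost (hc : Primrec c) (hd : Primrec d) (hs : Primrec s) (hr : Primrec r) :
    Primrec fun x => cost (c x) (d x) (s x) (r x) := by unfold cost; fun_prop

@[local fun_prop]
theorem primrec_gain (hc : Primrec c) (hd : Primrec d) (hs : Primrec s) (hr : Primrec r) :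
    Primrec fun x => gain (c x) (d x) (s x) (r x) := by unfold gain; fun_prop

@[local fun_prop]
theorem primrec_sim (hc : Primrec c) (hd : Primrec d) (hs : Primrec s) (ht : Primrec t) :
    Primrec fun x => sim (c x) (d x) (s x) (t x) := by unfold sim; fun_prop

@[local fun_prop]
theorem primrec_reset (hc : Primrec c) (hd : Primrec d) (hs : Primrec s) (hr : Primrec r) :
    Primrec fun x => reset lax (c x) (d x) (s x) (r x) := by unfold reset; fun_prop

@[local fun_prop]
theorem primrec_post {w : α → List ℕ} (hc : Primrec c) (hd : Primrec d) (hs : Primrec s)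
    (hw : Primrec w) (hr : Primrec r) :
    Primrec fun x => post lax (c x) (d x) (s x) (w x) (r x) := by unfold post; fun_prop

@[local fun_prop]
theorem primrec_tag (he : Primrec e) : Primrec fun x => tag (e x) := by unfold tag; fun_prop

@[local fun_prop]
theorem primrec_data (he : Primrec e) : Primrec fun x => data (e x) := by unfold data; fun_prop

@[local fun_prop]
theorem primrec_covers (hc : Primrec c) (he : Primrec e) :
    Primrec fun x => covers (c x) (e x) := by unfold covers; fun_prop

@[local fun_prop]
theorem primrec_claims (hc : Primrec c) (hL : Primrec L) (hg : Primrec g) (hq : Primrec q)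
    (hb : Primrec b) : Primrec fun x => claims (c x) (L x) (g x) (q x) (b x) := by
  unfold claims; fun_prop

@[local fun_prop]
theorem primrec_hits (hc : Primrec c) (hL : Primrec L) (he : Primrec e) (hs : Primrec s)
    (hq : Primrec q) : Primrec fun x => hits lax (c x) (L x) (e x) (s x) (q x) := by
  unfold hits; fun_prop

@[local fun_prop]
theorem primrec_force (hc : Primrec c) (hL : Primrec L) (he : Primrec e) :
    Primrec fun x => force lax (c x) (L x) (e x) := by unfold force; fun_prop

@[local fun_prop]
theorem primrec_misses (hc : Primrec c) (hL : Primrec L) (he : Primrec e) (hs : Primrec s)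
    (hq : Primrec q) : Primrec fun x => misses lax (c x) (L x) (e x) (s x) (q x) := by
  unfold misses; fun_prop

@[local fun_prop]
theorem primrec_foil (hc : Primrec c) (hL : Primrec L) (he : Primrec e) :
    Primrec fun x => foil lax (c x) (L x) (e x) := by unfold foil; fun_prop

@[local fun_prop]
theorem primrec_justified (hc : Primrec c) (hL : Primrec L) (he : Primrec e) :
    Primrec fun x => justified lax (c x) (L x) (e x) := by unfold justified; fun_prop

@[local fun_prop]
theorem primrec_check (hc : Primrec c) (hL : Primrec L) :
    Primrec fun x => check lax (c x) (L x) := by unfold check; fun_prop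

end

end Code

end Programs

/-! ### Codes of inputs -/

theorem allLt_iff {n : ℕ} {p : ℕ → Bool} : allLt n p = true ↔ ∀ x : Fin n, p x = true := by
  simp [allLt, List.all_eq_true, Fin.forall_iff]

theorem anyLt_iff {n : ℕ} {p : ℕ → Bool} : anyLt n p = true ↔ ∃ x : Fin n, p x = true := by
  simp [anyLt, List.any_eq_true, Fin.exists_iff]

theorem sumLt_eq (n : ℕ) (f : ℕ → ℕ) : sumLt n f = ∑ x : Fin n, f x := by
  rw [Fin.sum_univ_eq_sum_range, sumLt]
  rfl

theorem getD_ofFn {α : Type*} {n : ℕ} (f : Fin n → α) (i : Fin n) (d : α) :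
    (List.ofFn f).getD i d = f i := by
  simp [List.getD]

theorem getD_bits {n : ℕ} (S : Finset (Fin n)) (i : Fin n) :
    (bits S).getD i false = decide (i ∈ S) := getD_ofFn _ _ _

namespace Code

/-- The number of a joint action. -/
def num {n m : ℕ} (σ : Fin n → Fin m) : ℕ := (finFunctionFinEquiv σ : ℕ)

section

variable (I : Input) {rule : ShareRule}

theorem val_code (q : Fin I.states) (p : Fin I.props) :
    val I.code q p = decide (p ∈ I.model.val q) := by
  simp only [val, Input.code]
  rw [getD_ofFn, getD_bits]

theorem avail_code (a : Fin I.agents) (q : Fin I.states) (α : Fin I.actions) :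
    avail I.code a q α = decide (α ∈ I.model.avail a q) := by
  simp only [avail, Input.code]
  rw [getD_ofFn, getD_ofFn, getD_bits]

theorem step_code (q : Fin I.states) (σ : Fin I.agents → Fin I.actions) :
    step I.code q (num σ) = I.model.step q σ := by
  simp only [step, Input.code, num]
  rw [getD_ofFn, getD_ofFn, Equiv.symm_apply_apply]

theorem effect_code (α : Fin I.actions) (r : Fin I.resources) :
    effect I.code α r = (decide (I.model.t α r < 0), (I.model.t α r).natAbs) := by
  simp only [effect, Input.code]
  rw [getD_ofFn, getD_ofFn]

theorem act_code (σ : Fin I.agents → Fin I.actions) (a : Fin I.agents) :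
    act I.code (num σ) a = σ a := by
  have := finFunctionFinEquiv_symm_apply_val (finFunctionFinEquiv σ) a
  rw [Equiv.symm_apply_apply] at this
  exact this.symm

theorem allLt_moves {p : ℕ → Bool} : allLt (moves I.code) p = true ↔
    ∀ σ : Fin I.agents → Fin I.actions, p (num σ) = true :=
  allLt_iff.trans (Equiv.forall_congr_left finFunctionFinEquiv.symm)

theorem anyLt_moves {p : ℕ → Bool} : anyLt (moves I.code) p = true ↔
    ∃ σ : Fin I.agents → Fin I.actions, p (num σ) = true :=
  anyLt_iff.trans (Equiv.exists_congr_left finFunctionFinEquiv.symm)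

theorem allLt_resources {p : ℕ → Bool} : allLt I.code.1.2.2.2.2 p = true ↔
    ∀ r : Fin I.resources, p r = true := allLt_iff

theorem coalition_code {n r d : ℕ} {A : Finset (Fin n)} {η : Endowment (Fin n) (Fin r)}
    (hd : d = Encodable.encode (bits A, endowmentCode η)) :
    coalition d = (bits A, endowmentCode η) := by
  rw [coalition, hd, Encodable.encodek]
  rfl

theorem sum_cond_mem {n : ℕ} (A : Finset (Fin n)) (f : Fin n → ℕ) :
    ∑ a : Fin n, cond (decide (a ∈ A)) (f a) 0 = ∑ a ∈ A, f a := by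
  simp [Bool.cond_decide]

variable {A : Finset (Fin I.agents)} {η : Endowment (Fin I.agents) (Fin I.resources)} {d : ℕ}

theorem mem_code
    (hd : d = Encodable.encode (bits A, endowmentCode η)) (a : Fin I.agents) :
    mem d a = decide (a ∈ A) := by
  rw [mem, coalition_code hd, getD_bits]

theorem endow_code
    (hd : d = Encodable.encode (bits A, endowmentCode η)) (a : Fin I.agents) (r : Fin I.resources) :
    endow d a r = if η a r = ⊤ then none else some (η a r).toNat := by
  rw [endow, coalition_code hd]
  simp only [endowmentCode]
  rw [getD_ofFn, getD_ofFn]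

theorem unbounded_code
    (hd : d = Encodable.encode (bits A, endowmentCode η)) (r : Fin I.resources) :
    unbounded I.code d r = decide (total A η r = ⊤) := by
  rw [Bool.eq_iff_iff, decide_eq_true_iff, total_eq_top_iff, unbounded]
  refine anyLt_iff.trans (exists_congr fun (a : Fin I.agents) => ?_)
  rw [mem_code I hd, endow_code I hd]
  by_cases h : η a r = ⊤ <;> simp [h]

theorem coalitionSum_code
    (hd : d = Encodable.encode (bits A, endowmentCode η)) (r : Fin I.resources) (f : ℕ → ℕ) :
    coalitionSum I.code d r f = if total A η r = ⊤ then 0 else ∑ a ∈ A, f a := by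
  rw [coalitionSum, unbounded_code I hd, sumLt_eq, Bool.cond_decide]
  refine if_congr Iff.rfl rfl ?_
  refine Eq.trans ?_ (sum_cond_mem A fun a => f a)
  exact Finset.sum_congr rfl fun (a : Fin I.agents) _ => by rw [mem_code I hd]

theorem budget_code
    (hd : d = Encodable.encode (bits A, endowmentCode η)) (r : Fin I.resources) :
    budget I.code d r = RAL.budget A η r := by
  rw [budget, coalitionSum_code I hd]
  split_ifs with h
  · simp [RAL.budget, h]
  · have hne : ∀ a ∈ A, η a r ≠ ⊤ := fun a ha ht => h (total_eq_top_iff.mpr ⟨a, ha, ht⟩)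
    rw [RAL.budget, total, ENat.toNat_sum hne]
    refine Finset.sum_congr rfl fun a ha => ?_
    rw [endow_code I hd, if_neg (hne a ha)]
    rfl

theorem cost_code
    (hd : d = Encodable.encode (bits A, endowmentCode η))
    (σ : Fin I.agents → Fin I.actions) (r : Fin I.resources) :
    cost I.code d (num σ) r = (arena rule I.model A η).cost σ r := by
  rw [cost, coalitionSum_code I hd]
  simp only [arena]
  congr 1
  refine Finset.sum_congr rfl fun a _ => ?_
  rw [act_code, effect_code, RBM.cons]
  by_cases h : I.model.t (σ a) r < 0 <;> simp [h] <;> omega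

theorem gain_code
    (hd : d = Encodable.encode (bits A, endowmentCode η))
    (σ : Fin I.agents → Fin I.actions) (r : Fin I.resources) :
    gain I.code d (num σ) r = (arena rule I.model A η).gain σ r := by
  rw [gain, coalitionSum_code I hd]
  simp only [arena]
  congr 1
  refine Finset.sum_congr rfl fun a _ => ?_
  rw [act_code, effect_code, RBM.prod]
  by_cases h : I.model.t (σ a) r < 0 <;> simp [h] <;> omega

theorem joint_code (q : Fin I.states) (σ : Fin I.agents → Fin I.actions) :
    joint I.code q (num σ) = true ↔ (arena rule I.model A η).avail q σ := by
  refine allLt_iff.trans (forall_congr' fun (a : Fin I.agents) => ?_)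
  rw [act_code, avail_code, decide_eq_true_iff]

theorem sim_code
    (hd : d = Encodable.encode (bits A, endowmentCode η)) (σ σ' : Fin I.agents → Fin I.actions) :
    sim I.code d (num σ) (num σ') = true ↔ (arena rule I.model A η).sim σ σ' := by
  refine allLt_iff.trans (forall_congr' fun (a : Fin I.agents) => ?_)
  rw [act_code, act_code, mem_code I hd]
  by_cases h : a ∈ A <;> simp [h, Fin.ext_iff]

end

end Code

/-- The lax convention as a truth value. -/
def ShareRule.isLax : ShareRule → Bool
  | .lax => true
  | .exact => false

namespace Code

section

variable (I : Input) {rule : ShareRule} {A : Finset (Fin I.agents)}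
  {η : Endowment (Fin I.agents) (Fin I.resources)} {d : ℕ}

/-- The resources of an entry. -/
def vec (e : Entry) (r : Fin I.resources) : ℕ := e.2.2.2.1.getD r 0

theorem claims_iff {c : Code} {L : List Entry} {g q : ℕ} {b : Bool} : claims c L g q b = true ↔
    ∃ y ∈ L, y.1 = g ∧ y.2.1 = q ∧ y.2.2.1 = b ∧ covers c y = true := by
  simp [claims, List.any_eq_true, and_assoc]

/-- The coalition wins the game of `e` at `q` with the resources `w`, according to `L`. -/
def HitsAt (L : List Entry) (e : Entry) (q : ℕ) (w : Fin I.resources → ℕ) : Prop :=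
  if tag e = 3 then claims I.code L e.1.unpair.2.unpair.2 q true = true
  else ∃ y ∈ L, y.1 = e.1 ∧ y.2.1 = q ∧ y.2.2.1 = true ∧
    (tag e = 4 ∨ y.2.2.2.2 < e.2.2.2.2) ∧ ∀ r, vec I y r ≤ w r

/-- The coalition loses the game of `e` at `q` after the move `m`, according to `L`. -/
def MissesAt {Q Mv : Type*} (G : Arena Q Mv (Fin I.resources)) (L : List Entry) (e : Entry) (q : ℕ)
    (m : Mv) : Prop :=
  if tag e = 3 then claims I.code L e.1.unpair.2.unpair.2 q false = true
  else ∃ y ∈ L, y.1 = e.1 ∧ y.2.1 = q ∧ y.2.2.1 = false ∧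
    (tag e = 5 ∨ y.2.2.2.2 < e.2.2.2.2) ∧ G.BoundStep m (vec I e) (vec I y)

theorem reset_code
    (hd : d = Encodable.encode (bits A, endowmentCode η))
    (σ : Fin I.agents → Fin I.actions) (r : Fin I.resources) :
    reset rule.isLax I.code d (num σ) r = true ↔ (arena rule I.model A η).reset σ r := by
  rw [reset, cost_code I hd (rule := rule)]
  cases rule <;> simp [ShareRule.isLax, arena, or_iff_not_imp_left]

theorem post_code
    (hd : d = Encodable.encode (bits A, endowmentCode η))
    (σ : Fin I.agents → Fin I.actions) (e : Entry) (r : Fin I.resources) :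
    post rule.isLax I.code d (num σ) e.2.2.2.1 r =
      (arena rule I.model A η).post σ (vec I e) r := by
  rw [post, cost_code I hd (rule := rule), gain_code I hd (rule := rule)]
  by_cases h : (arena rule I.model A η).reset σ r
  · rw [(reset_code I hd σ r).2 h, Arena.post_of_reset h]
    rfl
  · rw [Bool.eq_false_iff.mpr (mt (reset_code I hd σ r).1 h), Arena.post_of_not_reset h]
    rfl

theorem covers_iff {e : Entry} (ht : 3 ≤ tag e)
    (hd : data e = Encodable.encode (bits A, endowmentCode η)) :
    covers I.code e = true ↔ if e.2.2.1 = true then ∀ r, vec I e r ≤ RAL.budget A η r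
      else Arena.Below (RAL.budget A η) (vec I e) := by
  rw [covers, Bool.or_eq_true, or_iff_right (by simpa using ht), allLt_resources]
  cases h : e.2.2.1
  · simp only [cond_false, Bool.or_eq_true, beq_iff_eq, Nat.blt_eq, Bool.false_eq_true, if_false]
    exact forall_congr' fun r => by rw [budget_code I hd]; rfl
  · simp only [cond_true, Nat.ble_eq, if_true]
    exact forall_congr' fun r => by rw [budget_code I hd]; rfl

theorem force_iff {e : Entry} {L : List Entry} {q : Fin I.states} (hq : e.2.1 = q)
    (hd : data e = Encodable.encode (bits A, endowmentCode η)) :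
    force rule.isLax I.code L e = true ↔
      (arena rule I.model A η).Force (fun q w => HitsAt I L e q w) q (vec I e) := by
  rw [force]
  refine (anyLt_moves I).trans (exists_congr fun σ => ?_)
  rw [Bool.and_eq_true, Bool.and_eq_true, allLt_resources, allLt_moves, hq,
    joint_code I (rule := rule) (A := A) (η := η), and_assoc]
  refine and_congr Iff.rfl (and_congr (forall_congr' fun r => ?_) (forall_congr' fun σ' => ?_))
  · rw [Nat.ble_eq, cost_code I hd (rule := rule)]
    rfl
  · rw [Bool.or_eq_true, Bool.or_eq_true, Bool.not_eq_true', Bool.not_eq_true',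
      ← Bool.not_eq_true, ← Bool.not_eq_true, joint_code I (rule := rule) (A := A) (η := η),
      sim_code I hd (rule := rule), step_code, ← imp_iff_not_or, ← imp_iff_not_or]
    refine imp_congr Iff.rfl (imp_congr Iff.rfl ?_)
    by_cases h3 : tag e = 3
    · simp only [hits, HitsAt, h3, beq_self_eq_true, cond_true, if_true]
      rfl
    · simp only [hits, HitsAt, beq_eq_false_iff_ne.mpr h3, cond_false, if_neg h3,
        List.any_eq_true, Bool.and_eq_true, Bool.or_eq_true, beq_iff_eq, Nat.blt_eq,
        allLt_resources, Nat.ble_eq, and_assoc]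
      simp only [post_code I hd (rule := rule)]
      rfl

theorem foil_iff {e : Entry} {L : List Entry} {q : Fin I.states} (hq : e.2.1 = q)
    (hd : data e = Encodable.encode (bits A, endowmentCode η)) :
    foil rule.isLax I.code L e = true ↔ (arena rule I.model A η).Foil
      (fun q m => MissesAt I (arena rule I.model A η) L e q m) q (vec I e) := by
  rw [foil]
  refine (allLt_moves I).trans (forall_congr' fun σ => ?_)
  rw [Bool.or_eq_true, Bool.or_eq_true, Bool.not_eq_true', Bool.not_eq_true',
    ← Bool.not_eq_true, ← Bool.not_eq_true, hq,
    joint_code I (rule := rule) (A := A) (η := η), or_assoc,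
    ← imp_iff_not_or, ← imp_iff_not_or, allLt_resources, anyLt_moves]
  refine imp_congr Iff.rfl (imp_congr (forall_congr' fun r => ?_) (exists_congr fun σ' => ?_))
  · rw [Bool.or_eq_true, beq_iff_eq, Nat.blt_eq, cost_code I hd (rule := rule)]
    rfl
  · rw [Bool.and_eq_true, Bool.and_eq_true, joint_code I (rule := rule) (A := A) (η := η),
      sim_code I hd (rule := rule), step_code]
    refine and_congr Iff.rfl (and_congr Iff.rfl ?_)
    by_cases h3 : tag e = 3
    · simp only [misses, MissesAt, h3, beq_self_eq_true, cond_true, if_true]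
      rfl
    · simp only [misses, MissesAt, beq_eq_false_iff_ne.mpr h3, cond_false, if_neg h3,
        List.any_eq_true, Bool.and_eq_true, Bool.or_eq_true, beq_iff_eq, Nat.blt_eq,
        allLt_resources, and_assoc, Bool.not_eq_true']
      refine exists_congr fun y => and_congr Iff.rfl (and_congr Iff.rfl (and_congr Iff.rfl
        (and_congr Iff.rfl (and_congr Iff.rfl (forall_congr' fun r => or_congr Iff.rfl ?_)))))
      rw [cost_code I hd (rule := rule), gain_code I hd (rule := rule)]
      by_cases h : (arena rule I.model A η).reset σ r
      · rw [(reset_code I hd σ r).2 h, if_pos h, cond_true, Nat.blt_eq]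
        rfl
      · rw [Bool.eq_false_iff.mpr (mt (reset_code I hd σ r).1 h), if_neg h, cond_false,
          Bool.and_eq_true, Nat.ble_eq, Bool.not_eq_true', beq_eq_false_iff_ne]
        rfl

end

end Code

/-! ### Correctness of the checker -/

namespace Code

section

variable {lax : Bool} {c : Code} {L L' : List Entry} {e : Entry}

theorem claims_mono (h : L ⊆ L') {g q : ℕ} {b : Bool} (hc : claims c L g q b = true) :
    claims c L' g q b = true := by
  obtain ⟨y, hy, hy'⟩ := claims_iff.mp hc
  exact claims_iff.mpr ⟨y, h hy, hy'⟩

theorem any_mono {α : Type*} {l l' : List α} (h : l ⊆ l') {p : α → Bool} (ha : l.any p = true) :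
    l'.any p = true := by
  rw [List.any_eq_true] at ha ⊢
  exact ha.imp fun x hx => ⟨h hx.1, hx.2⟩

theorem allLt_imp {n : ℕ} {p p' : ℕ → Bool} (h : ∀ x, p x = true → p' x = true)
    (ha : allLt n p = true) : allLt n p' = true :=
  allLt_iff.mpr fun x => h _ (allLt_iff.mp ha x)

theorem anyLt_imp {n : ℕ} {p p' : ℕ → Bool} (h : ∀ x, p x = true → p' x = true)
    (ha : anyLt n p = true) : anyLt n p' = true :=
  anyLt_iff.mpr ((anyLt_iff.mp ha).imp fun _ => h _)

theorem hits_mono (h : L ⊆ L') {s q : ℕ} (hc : hits lax c L e s q = true) :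
    hits lax c L' e s q = true := by
  unfold hits at hc ⊢
  cases h3 : tag e == 3 <;> rw [h3] at hc
  · exact any_mono h hc
  · exact claims_mono h hc

theorem misses_mono (h : L ⊆ L') {s q : ℕ} (hc : misses lax c L e s q = true) :
    misses lax c L' e s q = true := by
  unfold misses at hc ⊢
  cases h3 : tag e == 3 <;> rw [h3] at hc
  · exact any_mono h hc
  · exact claims_mono h hc

theorem force_mono (h : L ⊆ L') (hc : force lax c L e = true) : force lax c L' e = true := by
  refine anyLt_imp (fun s hs => ?_) hc
  rw [Bool.and_eq_true] at hs ⊢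
  refine ⟨hs.1, allLt_imp (fun s' hs' => ?_) hs.2⟩
  rw [Bool.or_eq_true, Bool.or_eq_true] at hs' ⊢
  exact hs'.imp_right (Or.imp_right (hits_mono h))

theorem foil_mono (h : L ⊆ L') (hc : foil lax c L e = true) : foil lax c L' e = true := by
  refine allLt_imp (fun s hs => ?_) hc
  rw [Bool.or_eq_true] at hs ⊢
  refine hs.imp_right (anyLt_imp fun s' hs' => ?_)
  rw [Bool.and_eq_true, Bool.and_eq_true] at hs' ⊢
  exact ⟨hs'.1, hs'.2.1, misses_mono h hs'.2.2⟩

/-- The claims of other entries are used only positively. -/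
theorem justified_mono (h : L ⊆ L') (hc : justified lax c L e = true) :
    justified lax c L' e = true := by
  have h1 : ∀ {g q b}, claims c L g q b = true → claims c L' g q b = true := claims_mono h
  have h2 : force lax c L e = true → force lax c L' e = true := force_mono h
  have h3 : foil lax c L e = true → foil lax c L' e = true := foil_mono h
  simp only [justified, Bool.cond_eq_ite] at hc ⊢
  split_ifs at hc ⊢ <;> try simp only [Bool.and_eq_true, Bool.or_eq_true] at hc ⊢
  · exact hc
  · exact h1 hc
  · exact hc.imp h1 h1
  · exact hc.imp h1 h1
  · exact h2 hc
  · exact h3 hc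
  · exact hc.imp h1 h2
  · exact hc.imp h1 h3
  · exact hc.imp h1 (And.imp h1 h2)
  · exact hc.imp h1 (Or.imp h1 h3)

theorem check_iff : check lax c L = true ↔ ∀ e ∈ L, justified lax c L e = true := List.all_eq_true

theorem check_append (h : check lax c L = true)
    (h' : ∀ e ∈ L', justified lax c (L ++ L') e = true) :
    check lax c (L ++ L') = true := by
  rw [check_iff] at h ⊢
  intro e he
  rcases List.mem_append.mp he with he | he
  · exact justified_mono (List.subset_append_left _ _) (h e he)
  · exact h' e he

/-- Certificates for the single states combine to one for all states. -/
theorem exists_check_forall {n : ℕ} {g : ℕ} {b : Fin n → Bool}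
    (h : ∀ q : Fin n, ∃ L, check lax c L = true ∧ claims c L g q (b q) = true) :
    ∃ L, check lax c L = true ∧ ∀ q : Fin n, claims c L g q (b q) = true := by
  choose L h1 h2 using h
  have hsub : ∀ q, L q ⊆ (List.ofFn L).flatten := fun q x hx =>
    List.mem_flatten.mpr ⟨L q, (List.mem_ofFn' _ _).mpr ⟨q, rfl⟩, hx⟩
  refine ⟨(List.ofFn L).flatten, check_iff.mpr fun e he => ?_, fun q => claims_mono (hsub q) (h2 q)⟩
  obtain ⟨l, hl, he⟩ := List.mem_flatten.mp he
  obtain ⟨q, rfl⟩ := (List.mem_ofFn' _ _).mp hl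
  exact justified_mono (hsub q) (check_iff.mp (h1 q) e he)

/-- A certificate together with a finite set of further entries is a certificate. -/
theorem exists_check_of_finite {C : Set Entry} (hC : C.Finite) (h : check lax c L = true)
    (hj : ∀ L', L ⊆ L' → (∀ y ∈ C, y ∈ L') → ∀ y ∈ C, justified lax c L' y = true) {g q : ℕ}
    {b : Bool} (hy : ∃ y ∈ C, y.1 = g ∧ y.2.1 = q ∧ y.2.2.1 = b ∧ covers c y = true) :
    ∃ L', check lax c L' = true ∧ claims c L' g q b = true := by
  refine ⟨L ++ hC.toFinset.toList, check_append h fun x hx => ?_, ?_⟩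
  · exact hj _ (List.subset_append_left _ _) (fun z hz => by simp [hz]) x (by simpa using hx)
  · exact claims_iff.mpr (hy.imp fun y hy => ⟨by simp [hy.1], hy.2⟩)

theorem exists_check_cons (h : check lax c L = true) (y : Entry)
    (hj : ∀ L', L ⊆ L' → justified lax c L' y = true) {g q : ℕ} {b : Bool} (hg : y.1 = g)
    (hq : y.2.1 = q) (hb : y.2.2.1 = b) (hcov : covers c y = true) :
    ∃ L', check lax c L' = true ∧ claims c L' g q b = true :=
  exists_check_of_finite (Set.finite_singleton y) h
    (fun L' hL' _ _ hz => Set.mem_singleton_iff.mp hz ▸ hj L' hL') ⟨y, rfl, hg, hq, hb, hcov⟩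

end

section

variable (I : Input) {rule : ShareRule} {L : List Entry}

/-- The entry with formula code `g` and truth value `b` for a state, resources and a rank. -/
def entry (g : ℕ) (b : Bool) (x : Fin I.states × (Fin I.resources → ℕ) × ℕ) : Entry :=
  (g, x.1, b, List.ofFn x.2.1, x.2.2)

/-- The positions for which `L` has an entry with formula code `g` and truth value `b`. -/
def positions (L : List Entry) (g : ℕ) (b : Bool) :
    Arena.Entries (Fin I.states) (Fin I.resources) :=
  {x | ∃ y ∈ L, y.1 = g ∧ y.2.1 = x.1 ∧ y.2.2.1 = b ∧ vec I y = x.2.1 ∧ y.2.2.2.2 = x.2.2}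

theorem vec_entry (g : ℕ) (b : Bool) (x : Fin I.states × (Fin I.resources → ℕ) × ℕ) :
    vec I (entry I g b x) = x.2.1 := by
  funext r
  exact getD_ofFn _ _ _

theorem force_imp {e : Entry} (h4 : tag e ≠ 3) {q : Fin I.states}
    {G : Arena (Fin I.states) (Fin I.agents → Fin I.actions) (Fin I.resources)}
    (h : G.Force (fun q w => HitsAt I L e q w) q (vec I e)) :
    G.Force (fun q w => ∃ y ∈ positions I L e.1 true, y.1 = q ∧
      (tag e = 4 ∨ y.2.2 < e.2.2.2.2) ∧ ∀ r, y.2.1 r ≤ w r) q (vec I e) := by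
  refine h.imp fun q w h => ?_
  rw [HitsAt, if_neg h4] at h
  obtain ⟨y, y1, y2, y3, y4, y5, y6⟩ := h
  exact ⟨(q, vec I y, y.2.2.2.2), ⟨y, y1, y2, y3, y4, rfl, rfl⟩, rfl, y5, y6⟩

theorem foil_imp {e : Entry} (h4 : tag e ≠ 3) {q : Fin I.states}
    {G : Arena (Fin I.states) (Fin I.agents → Fin I.actions) (Fin I.resources)}
    (h : G.Foil (fun q m => MissesAt I G L e q m) q (vec I e)) :
    G.Foil (fun q m => ∃ y ∈ positions I L e.1 false, y.1 = q ∧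
      (tag e = 5 ∨ y.2.2 < e.2.2.2.2) ∧ G.BoundStep m (vec I e) y.2.1) q (vec I e) := by
  refine h.imp fun q w h => ?_
  rw [MissesAt, if_neg h4] at h
  obtain ⟨y, y1, y2, y3, y4, y5, y6⟩ := h
  exact ⟨(q, vec I y, y.2.2.2.2), ⟨y, y1, y2, y3, y4, rfl, rfl⟩, rfl, y5, y6⟩

/-- The claims of a certificate are true. -/
theorem claims_sound (hL : check rule.isLax I.code L = true)
    (φ : Formula (Fin I.agents) (Fin I.props) (Fin I.resources)) (q : Fin I.states) (b : Bool)
    (h : claims I.code L (formulaCode φ) q b = true) : Sat rule I.model φ q ↔ b = true := by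
  rw [check_iff] at hL
  have : Nonempty (Fin I.actions) := ⟨⟨0, I.actions_pos⟩⟩
  induction φ generalizing q b with
  | prop x =>
    obtain ⟨e, he, e1, e2, e3, -⟩ := claims_iff.mp h
    have hj := hL e he
    simp [justified, tag, e1, e2, e3, formulaCode, val_code] at hj
    simp [Sat, hj]
  | neg φ ih =>
    obtain ⟨e, he, e1, e2, e3, -⟩ := claims_iff.mp h
    have hj := hL e he
    simp [justified, tag, e1, e2, e3, formulaCode] at hj
    simp [Sat, ih q _ hj]
  | and φ ψ ih1 ih2 =>
    obtain ⟨e, he, e1, e2, e3, -⟩ := claims_iff.mp h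
    have hj := hL e he
    cases b
    · simp [justified, tag, e1, e2, e3, formulaCode] at hj
      rcases hj with hj | hj
      · simp [Sat, ih1 q _ hj]
      · simp [Sat, ih2 q _ hj]
    · simp [justified, tag, e1, e2, e3, formulaCode] at hj
      simp [Sat, ih1 q _ hj.1, ih2 q _ hj.2]
  | next A hA η φ ih =>
    obtain ⟨e, he, e1, e2, e3, e4⟩ := claims_iff.mp h
    have hj := hL e he
    have ht : tag e = 3 := by simp [tag, e1, formulaCode]
    have hd : data e = Encodable.encode (bits A, endowmentCode η) := by
      simp [data, e1, formulaCode]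
    have hg : e.1.unpair.2.unpair.2 = formulaCode φ := by simp [e1, formulaCode]
    rw [covers_iff I (by omega) hd, e3] at e4
    simp only [justified, ht, e3] at hj
    rw [Sat, forall_out_next_iff]
    cases b
    · simp only [Bool.false_eq_true, if_false] at e4
      have hf := (foil_iff I (rule := rule) e2 hd).mp hj
      simp only [Bool.false_eq_true, iff_false]
      rintro ⟨m, h1, h2, h3⟩
      obtain ⟨m', a1, a2, a3⟩ := hf m h1 (e4.cost_below h2)
      rw [MissesAt, if_pos ht, hg] at a3
      simpa using (ih _ _ a3).mp (h3 m' a1 a2)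
    · simp only [if_true] at e4
      have hf := (force_iff I (rule := rule) e2 hd).mp hj
      simp only [iff_true]
      refine (hf.mono (fun p w w' _ hx => ?_) e4).imp fun p w hx => ?_
      · rw [HitsAt, if_pos ht] at hx ⊢
        exact hx
      · rw [HitsAt, if_pos ht, hg] at hx
        exact (ih p true hx).mpr rfl
  | always A hA η φ ih =>
    obtain ⟨e, he, e1, e2, e3, e4⟩ := claims_iff.mp h
    have hpos : (q, vec I e, e.2.2.2.2) ∈ positions I L (formulaCode (.always A hA η φ)) b :=
      ⟨e, he, e1, e2, e3, rfl, rfl⟩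
    have key : ∀ x ∈ positions I L (formulaCode (.always A hA η φ)) b, ∃ y : Entry,
        y.1 = formulaCode (.always A hA η φ) ∧ vec I y = x.2.1 ∧ y.2.2.2.2 = x.2.2 ∧ tag y = 4 ∧
        cond b (claims I.code L (formulaCode φ) x.1 true && force rule.isLax I.code L y)
          (claims I.code L (formulaCode φ) x.1 false || foil rule.isLax I.code L y) = true ∧
        y.2.1 = x.1 ∧ data y = Encodable.encode (bits A, endowmentCode η) := by
      rintro x ⟨y, y1, y2, y3, y4, y5, y6⟩
      have hj := hL y y1
      have ht : tag y = 4 := by simp [tag, y2, formulaCode]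
      refine ⟨y, y2, y5, y6, ht, ?_, y3, by simp [data, y2, formulaCode]⟩
      simp only [justified, ht, y3, y4] at hj
      simpa [y2, formulaCode] using hj
    have hd : data e = Encodable.encode (bits A, endowmentCode η) := by
      simp [data, e1, formulaCode]
    rw [covers_iff I (by simp [tag, e1, formulaCode]) hd, e3] at e4
    rw [Sat, forall_out_always_iff]
    cases b
    · simp only [Bool.false_eq_true, if_false] at e4
      simp only [Bool.false_eq_true, iff_false]
      refine Arena.not_safe_of_entries (fun x hx => ?_) _ hpos _ e4
      obtain ⟨y, y1, y2, y3, y4, y5, y6, y7⟩ := key x hx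
      rw [cond_false, Bool.or_eq_true] at y5
      refine y5.imp (fun h => ?_) fun h => ?_
      · simpa using ih x.1 false h
      · have := foil_imp I (by omega) ((foil_iff I (rule := rule) y6 y7).mp h)
        rw [y1, y2, y3, y4] at this
        simpa using this
    · simp only [if_true] at e4
      simp only [iff_true]
      refine (Arena.safe_of_entries (fun x hx => ?_) _ hpos).mono e4
      obtain ⟨y, y1, y2, y3, y4, y5, y6, y7⟩ := key x hx
      rw [cond_true, Bool.and_eq_true] at y5
      refine y5.imp (fun h => ?_) fun h => ?_
      · simpa using ih x.1 true h
      · have := force_imp I (by omega) ((force_iff I (rule := rule) y6 y7).mp h)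
        rw [y1, y2, y4] at this
        simpa using this
  | _ A hA η φ ψ ih1 ih2 =>
    obtain ⟨e, he, e1, e2, e3, e4⟩ := claims_iff.mp h
    have hpos : (q, vec I e, e.2.2.2.2) ∈ positions I L (formulaCode (.until A hA η φ ψ)) b :=
      ⟨e, he, e1, e2, e3, rfl, rfl⟩
    have key : ∀ x ∈ positions I L (formulaCode (.until A hA η φ ψ)) b, ∃ y : Entry,
        y.1 = formulaCode (.until A hA η φ ψ) ∧ vec I y = x.2.1 ∧ y.2.2.2.2 = x.2.2 ∧ tag y = 5 ∧
        cond b (claims I.code L (formulaCode ψ) x.1 true ||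
            (claims I.code L (formulaCode φ) x.1 true && force rule.isLax I.code L y))
          (claims I.code L (formulaCode ψ) x.1 false &&
            (claims I.code L (formulaCode φ) x.1 false || foil rule.isLax I.code L y)) = true ∧
        y.2.1 = x.1 ∧ data y = Encodable.encode (bits A, endowmentCode η) := by
      rintro x ⟨y, y1, y2, y3, y4, y5, y6⟩
      have hj := hL y y1
      have ht : tag y = 5 := by simp [tag, y2, formulaCode]
      refine ⟨y, y2, y5, y6, ht, ?_, y3, by simp [data, y2, formulaCode]⟩
      simp only [justified, ht, y3, y4] at hj
      simpa [y2, formulaCode] using hj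
    have hd : data e = Encodable.encode (bits A, endowmentCode η) := by
      simp [data, e1, formulaCode]
    rw [covers_iff I (by simp [tag, e1, formulaCode]) hd, e3] at e4
    rw [Sat, forall_out_until_iff]
    cases b
    · simp only [Bool.false_eq_true, if_false] at e4
      simp only [Bool.false_eq_true, iff_false]
      refine Arena.not_reach_of_entries (fun x hx => ?_) _ hpos _ e4
      obtain ⟨y, y1, y2, y3, y4, y5, y6, y7⟩ := key x hx
      rw [cond_false, Bool.and_eq_true, Bool.or_eq_true] at y5
      refine y5.imp (fun h => ?_) (Or.imp (fun h => ?_) fun h => ?_)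
      · simpa using ih2 x.1 false h
      · simpa using ih1 x.1 false h
      · have := foil_imp I (by omega) ((foil_iff I (rule := rule) y6 y7).mp h)
        rw [y1, y2, y4] at this
        simpa using this
    · simp only [if_true] at e4
      simp only [iff_true]
      refine (Arena.reach_of_entries (fun x hx => ?_) _ hpos).mono e4
      obtain ⟨y, y1, y2, y3, y4, y5, y6, y7⟩ := key x hx
      rw [cond_true, Bool.or_eq_true, Bool.and_eq_true] at y5
      refine y5.imp (fun h => ?_) (And.imp (fun h => ?_) fun h => ?_)
      · simpa using ih2 x.1 true h
      · simpa using ih1 x.1 true h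
      · have := force_imp I (by omega) ((force_iff I (rule := rule) y6 y7).mp h)
        rw [y1, y2, y3, y4] at this
        simpa using this

end

variable (I : Input) {rule : ShareRule} {L : List Entry}

theorem force_of_entries {C : Arena.Entries (Fin I.states) (Fin I.resources)} {g : ℕ}
    (hC : ∀ x ∈ C, entry I g true x ∈ L) {x : Fin I.states × (Fin I.resources → ℕ) × ℕ}
    (ht : tag (entry I g true x) ≠ 3)
    {A : Finset (Fin I.agents)} {η : Endowment (Fin I.agents) (Fin I.resources)}
    (hd : data (entry I g true x) = Encodable.encode (bits A, endowmentCode η))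
    (h : (arena rule I.model A η).Force (fun q w => ∃ y ∈ C, y.1 = q ∧
      (tag (entry I g true x) = 4 ∨ y.2.2 < x.2.2) ∧ ∀ r, y.2.1 r ≤ w r) x.1 x.2.1) :
    force rule.isLax I.code L (entry I g true x) = true := by
  rw [force_iff I (q := x.1) rfl hd, vec_entry]
  refine h.imp fun q w h => ?_
  rw [HitsAt, if_neg ht]
  obtain ⟨y, y1, rfl, y3, y4⟩ := h
  exact ⟨_, hC y y1, rfl, rfl, rfl, y3, by rwa [vec_entry]⟩

theorem foil_of_entries {C : Arena.Entries (Fin I.states) (Fin I.resources)} {g : ℕ}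
    (hC : ∀ x ∈ C, entry I g false x ∈ L) {x : Fin I.states × (Fin I.resources → ℕ) × ℕ}
    (ht : tag (entry I g false x) ≠ 3)
    {A : Finset (Fin I.agents)} {η : Endowment (Fin I.agents) (Fin I.resources)}
    (hd : data (entry I g false x) = Encodable.encode (bits A, endowmentCode η))
    (h : (arena rule I.model A η).Foil (fun q m => ∃ y ∈ C, y.1 = q ∧
      (tag (entry I g false x) = 5 ∨ y.2.2 < x.2.2) ∧
      (arena rule I.model A η).BoundStep m x.2.1 y.2.1) x.1 x.2.1) :
    foil rule.isLax I.code L (entry I g false x) = true := by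
  rw [foil_iff I (q := x.1) rfl hd, vec_entry]
  refine h.imp fun q m h => ?_
  rw [MissesAt, if_neg ht]
  obtain ⟨y, y1, rfl, y3, y4⟩ := h
  exact ⟨_, hC y y1, rfl, rfl, rfl, y3, by rwa [vec_entry, vec_entry]⟩

theorem below_add_one {Res : Type*} (w : Res → ℕ) : Arena.Below w fun r => w r + 1 :=
  fun r => Or.inr (Nat.lt_succ_self (w r))

open Classical in
/-- Every true claim has a certificate. -/
theorem exists_check_claims (φ : Formula (Fin I.agents) (Fin I.props) (Fin I.resources)) :
    ∃ L, check rule.isLax I.code L = true ∧ ∀ q : Fin I.states,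
      claims I.code L (formulaCode φ) q (decide (Sat rule I.model φ q)) = true := by
  have : Nonempty (Fin I.actions) := ⟨⟨0, I.actions_pos⟩⟩
  induction φ with
  | prop p =>
    refine exists_check_forall fun q => ?_
    set f := formulaCode (.prop p : Formula (Fin I.agents) (Fin I.props) (Fin I.resources))
    refine exists_check_cons (L := []) (check_iff.mpr (by simp))
      (entry I f (decide (Sat rule I.model (.prop p) q)) (q, 0, 0))
      ?_ rfl rfl rfl (by simp [covers, tag, entry, f, formulaCode])
    intro L' _
    by_cases s1 : p ∈ I.model.val q <;>
      simp [justified, tag, entry, f, formulaCode, Sat, val_code, s1]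
  | neg φ ih =>
    obtain ⟨L, hL, hφ⟩ := ih
    refine exists_check_forall fun q => ?_
    refine exists_check_cons hL
      (entry I (formulaCode (.neg φ)) (decide (Sat rule I.model (.neg φ) q)) (q, 0, 0))
      ?_ rfl rfl rfl (by simp [covers, tag, entry, formulaCode])
    intro L' hsub
    have h1 := claims_mono hsub (hφ q)
    by_cases s1 : Sat rule I.model φ q <;>
      simpa [justified, tag, entry, formulaCode, Sat, s1] using h1
  | and φ ψ ih1 ih2 =>
    obtain ⟨L, hL, hφ⟩ := ih1
    obtain ⟨K, hK, hψ⟩ := ih2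
    refine exists_check_forall fun q => ?_
    refine exists_check_cons (check_append hL fun e he =>
        justified_mono (List.subset_append_right _ _) (check_iff.mp hK e he))
      (entry I (formulaCode (.and φ ψ)) (decide (Sat rule I.model (.and φ ψ) q)) (q, 0, 0))
      ?_ rfl rfl rfl (by simp [covers, tag, entry, formulaCode])
    intro L' hsub
    have h1 := claims_mono (List.Subset.trans (List.subset_append_left _ _) hsub) (hφ q)
    have h2 := claims_mono (List.Subset.trans (List.subset_append_right _ _) hsub) (hψ q)
    simp only [justified, tag, entry, formulaCode, Sat, Nat.unpair_pair]
    by_cases s1 : Sat rule I.model φ q <;> by_cases s2 : Sat rule I.model ψ q <;>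
      simp_all
  | next A hA η φ ih =>
    obtain ⟨L, hL, hφ⟩ := ih
    refine exists_check_forall fun q => ?_
    set f := formulaCode (.next A hA η φ)
    have ht : ∀ b x, tag (entry I f b x) = 3 := fun b x => by simp [tag, entry, f, formulaCode]
    have hd : ∀ b x, data (entry I f b x) = Encodable.encode (bits A, endowmentCode η) :=
      fun b x => by simp [data, entry, f, formulaCode]
    have hg : ∀ b x, (entry I f b x).1.unpair.2.unpair.2 = formulaCode φ := fun b x => by
      simp [entry, f, formulaCode]
    by_cases hs : Sat rule I.model (.next A hA η φ) q
    · rw [decide_eq_true hs]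
      rw [Sat, forall_out_next_iff] at hs
      refine exists_check_cons hL (entry I f true (q, RAL.budget A η, 0)) ?_ rfl rfl rfl
        ((covers_iff I (ht _ _).ge (hd _ _)).mpr (by simp [entry, vec]))
      intro L' hsub
      simp only [justified, ht]
      refine (force_iff I (q := q) rfl (hd _ _)).mpr ?_
      rw [vec_entry]
      refine hs.imp fun p w hp => ?_
      rw [HitsAt, if_pos (ht _ _), hg]
      exact claims_mono hsub (by simpa [hp] using hφ p)
    · rw [decide_eq_false hs]
      rw [Sat, forall_out_next_iff] at hs
      refine exists_check_cons hL (entry I f false (q, (fun r => RAL.budget A η r + 1), 0))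
        ?_ rfl rfl rfl
        ((covers_iff I (ht _ _).ge (hd _ _)).mpr ?_)
      · intro L' hsub
        simp only [justified, ht]
        refine (foil_iff I (q := q) rfl (hd _ _)).mpr ?_
        rw [vec_entry]
        intro m h1 h2
        obtain ⟨m', a1, a2, a3⟩ := Arena.not_force hs h1 fun r => by
          have := h2 r
          dsimp only at this
          omega
        refine ⟨m', a1, a2, ?_⟩
        dsimp only
        rw [MissesAt, if_pos (ht _ _), hg]
        have := hφ ((arena rule I.model A η).succ q m')
        rw [decide_eq_false a3] at this
        exact claims_mono hsub this
      · rw [vec_entry]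
        simpa [entry] using below_add_one _
  | always A hA η φ ih =>
    obtain ⟨L, hL, hφ⟩ := ih
    refine exists_check_forall fun q => ?_
    set f := formulaCode (.always A hA η φ)
    have ht : ∀ b x, tag (entry I f b x) = 4 := fun b x => by simp [tag, entry, f, formulaCode]
    have hd : ∀ b x, data (entry I f b x) = Encodable.encode (bits A, endowmentCode η) :=
      fun b x => by simp [data, entry, f, formulaCode]
    have hg : ∀ b x, (entry I f b x).1.unpair.2.unpair.2 = formulaCode φ := fun b x => by
      simp [entry, f, formulaCode]
    have ht3 : ∀ b x, tag (entry I f b x) ≠ 3 := fun b x => by rw [ht]; decide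
    by_cases hs : Sat rule I.model (.always A hA η φ) q
    · rw [decide_eq_true hs]
      rw [Sat, forall_out_always_iff] at hs
      obtain ⟨C, c1, ⟨⟨p, w, k⟩, c2, rfl, c3⟩, c4⟩ := Arena.exists_entries_of_safe q _ hs
      refine exists_check_of_finite (c1.image (entry I f true)) hL ?_
        ⟨_, ⟨_, c2, rfl⟩, rfl, rfl, rfl, (covers_iff I (by rw [ht]; decide) (hd _ _)).mpr (by
          rw [vec_entry]; simpa [entry] using c3)⟩
      rintro L' hsub hmem _ ⟨x, hx, rfl⟩
      simp only [justified, ht, hg]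
      refine (Bool.and_eq_true _ _).mpr ⟨claims_mono hsub ?_, force_of_entries I
        (fun y hy => hmem _ ⟨y, hy, rfl⟩) (ht3 _ _) (hd _ _) ?_⟩
      · simpa [entry, (c4 x hx).1] using hφ x.1
      · simpa [ht] using (c4 x hx).2
    · rw [decide_eq_false hs]
      rw [Sat, forall_out_always_iff, Arena.Safe, not_forall] at hs
      obtain ⟨k, hk⟩ := hs
      obtain ⟨C, c1, c2, c3⟩ := Arena.exists_entries_of_not_safeFor k q _ hk
      refine exists_check_of_finite (c1.image (entry I f false)) hL ?_
        ⟨_, ⟨_, c2, rfl⟩, rfl, rfl, rfl, (covers_iff I (by rw [ht]; decide) (hd _ _)).mpr (by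
          rw [vec_entry]; simpa [entry] using below_add_one _)⟩
      rintro L' hsub hmem _ ⟨x, hx, rfl⟩
      simp only [justified, ht, hg]
      refine (Bool.or_eq_true _ _).mpr ((c3 x hx).imp (fun h => claims_mono hsub ?_) fun h =>
        foil_of_entries I (fun y hy => hmem _ ⟨y, hy, rfl⟩) (ht3 _ _) (hd _ _) ?_)
      · simpa [entry, h] using hφ x.1
      · simpa [ht] using h
  | _ A hA η φ ψ ih1 ih2 =>
    obtain ⟨L, hL, hφ⟩ := ih1
    obtain ⟨K, hK, hψ⟩ := ih2
    have hLK : check rule.isLax I.code (L ++ K) = true := check_append hL fun e he =>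
      justified_mono (List.subset_append_right _ _) (check_iff.mp hK e he)
    replace hφ := fun q => claims_mono (List.subset_append_left L K) (hφ q)
    replace hψ := fun q => claims_mono (List.subset_append_right L K) (hψ q)
    refine exists_check_forall fun q => ?_
    set f := formulaCode (.until A hA η φ ψ)
    have ht : ∀ b x, tag (entry I f b x) = 5 := fun b x => by simp [tag, entry, f, formulaCode]
    have hd : ∀ b x, data (entry I f b x) = Encodable.encode (bits A, endowmentCode η) :=
      fun b x => by simp [data, entry, f, formulaCode]
    have hg1 : ∀ b x, (entry I f b x).1.unpair.2.unpair.2.unpair.1 = formulaCode φ :=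
      fun b x => by simp [entry, f, formulaCode]
    have hg2 : ∀ b x, (entry I f b x).1.unpair.2.unpair.2.unpair.2 = formulaCode ψ :=
      fun b x => by simp [entry, f, formulaCode]
    have ht3 : ∀ b x, tag (entry I f b x) ≠ 3 := fun b x => by rw [ht]; decide
    by_cases hs : Sat rule I.model (.until A hA η φ ψ) q
    · rw [decide_eq_true hs]
      rw [Sat, forall_out_until_iff] at hs
      obtain ⟨k, hk⟩ := hs
      obtain ⟨C, c1, c2, c3⟩ := Arena.exists_entries_of_reachIn k q _ hk
      refine exists_check_of_finite (c1.image (entry I f true)) hLK ?_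
        ⟨_, ⟨_, c2, rfl⟩, rfl, rfl, rfl, (covers_iff I (by rw [ht]; decide) (hd _ _)).mpr (by
          rw [vec_entry]; simp [entry])⟩
      rintro L' hsub hmem _ ⟨x, hx, rfl⟩
      simp only [justified, ht, hg1, hg2]
      refine (Bool.or_eq_true _ _).mpr ((c3 x hx).imp (fun h => claims_mono hsub ?_) fun h =>
        (Bool.and_eq_true _ _).mpr ⟨claims_mono hsub ?_, force_of_entries I
        (fun y hy => hmem _ ⟨y, hy, rfl⟩) (ht3 _ _) (hd _ _) ?_⟩)
      · simpa [entry, h] using hψ x.1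
      · simpa [entry, h.1] using hφ x.1
      · simpa [ht] using h.2
    · rw [decide_eq_false hs]
      rw [Sat, forall_out_until_iff] at hs
      obtain ⟨C, c1, ⟨⟨p, w, k⟩, c2, rfl, c3⟩, c4⟩ := Arena.exists_entries_of_not_reach q _ hs
      refine exists_check_of_finite (c1.image (entry I f false)) hLK ?_
        ⟨_, ⟨_, c2, rfl⟩, rfl, rfl, rfl, (covers_iff I (by rw [ht]; decide) (hd _ _)).mpr (by
          rw [vec_entry]; simpa [entry] using c3)⟩
      rintro L' hsub hmem _ ⟨x, hx, rfl⟩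
      simp only [justified, ht, hg1, hg2]
      refine (Bool.and_eq_true _ _).mpr ((c4 x hx).imp (fun h => claims_mono hsub ?_) fun h =>
        (Bool.or_eq_true _ _).mpr (h.imp (fun h => claims_mono hsub ?_) fun h => foil_of_entries I
        (fun y hy => hmem _ ⟨y, hy, rfl⟩) (ht3 _ _) (hd _ _) ?_))
      · simpa [entry, h] using hψ x.1
      · simpa [entry, h] using hφ x.1
      · simpa [ht] using h

end Code

/-! ### Validity of codes -/

section Validity

attribute [local fun_prop] Primrec Primrec.id Primrec.const Primrec.comp Primrec.pair primrec_fst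
  primrec_snd primrec_pow primrec_beq primrec_blt primrec_and primrec_or primrec_not primrec_cond
  primrec_getD primrec_length primrec_unpair primrec_encode primrec_all primrec_any
  Code.primrec_coalition Code.primrec_claims Code.primrec_check

variable {n k r : ℕ}

theorem lt_natPair {a : ℕ} (ha : 0 < a) (b : ℕ) : b < Nat.pair a b := by
  unfold Nat.pair
  split_ifs <;> nlinarith

/-- A list of the right length is the table of its entries. -/
theorem ofFn_eq {α : Type*} {l : List α} {f : Fin n → α} (d : α) (hl : l.length = n)
    (h : ∀ i : Fin n, f i = l.getD i d) : List.ofFn f = l := by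
  refine List.ext_getElem (by simp [hl]) fun i h1 h2 => ?_
  rw [List.length_ofFn] at h1
  simpa [h2] using h ⟨i, h1⟩

theorem bits_filter {l : List Bool} (hl : l.length = n) :
    bits (Finset.univ.filter fun i : Fin n => l.getD i false = true) = l :=
  ofFn_eq false hl fun i => by simp

theorem mem_of_getD {α : Type*} {l : List α} {i : ℕ} (d : α) (h : i < l.length) :
    l.getD i d ∈ l := by
  simp [h]

/-- Sign and absolute value of an integer recover the pair they were read from, unless this is a
negative zero. -/
theorem signed_eq {e : Bool × ℕ} (h : (!(e.1 && e.2 == 0)) = true) :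
    (decide (cond e.1 (-(e.2 : ℤ)) (e.2 : ℤ) < 0), (cond e.1 (-(e.2 : ℤ)) (e.2 : ℤ)).natAbs) =
      e := by
  obtain ⟨_ | _, x⟩ := e
  · simp
  · simpa [Nat.pos_iff_ne_zero] using h

/-- Whether `d` is the code of a non-empty coalition of `n` agents and an endowment of these with
`r` resources. -/
def dataValid (n r d : ℕ) : Bool :=
  (Encodable.encode (Code.coalition d) == d && (Code.coalition d).1.length == n) &&
    ((Code.coalition d).1.any (fun b => b) && ((Code.coalition d).2.length == n &&
      (Code.coalition d).2.all fun l => l.length == r))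

theorem dataValid_iff {d : ℕ} : dataValid n r d = true ↔
    ∃ (A : Finset (Fin n)) (η : Endowment (Fin n) (Fin r)), A.Nonempty ∧
      d = Encodable.encode (bits A, endowmentCode η) := by
  simp only [dataValid, Bool.and_eq_true, beq_iff_eq, List.any_eq_true, List.all_eq_true]
  constructor
  · rintro ⟨⟨h1, h2⟩, ⟨b, hb, rfl⟩, h3, h4⟩
    refine ⟨Finset.univ.filter fun i : Fin n => (Code.coalition d).1.getD i false = true,
      fun a x => (((Code.coalition d).2.getD a []).getD x none).elim ⊤ fun v => (v : ℕ∞), ?_, ?_⟩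
    · obtain ⟨i, hi, h⟩ := List.mem_iff_getElem.mp hb
      exact ⟨⟨i, h2 ▸ hi⟩, by simp [hi, h]⟩
    · rw [bits_filter h2]
      have : endowmentCode (n := n) (r := r) (fun a x =>
          (((Code.coalition d).2.getD a []).getD x none).elim ⊤ fun v => (v : ℕ∞)) =
          (Code.coalition d).2 := by
        refine ofFn_eq [] h3 fun a =>
          ofFn_eq none (h4 _ (mem_of_getD _ (a.2.trans_eq h3.symm))) fun x => ?_
        beta_reduce
        generalize ((Code.coalition d).2.getD a []).getD x none = o
        cases o <;> simp
      rw [this]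
      exact h1.symm
  · rintro ⟨A, η, ⟨a, ha⟩, rfl⟩
    rw [Code.coalition_code rfl]
    refine ⟨⟨rfl, by simp [bits]⟩, ⟨true, ?_, rfl⟩, by simp [endowmentCode], ?_⟩
    · exact (List.mem_ofFn' _ _).mpr ⟨a, by simp [ha]⟩
    · intro l hl
      obtain ⟨b, rfl⟩ := (List.mem_ofFn' _ _).mp hl
      simp

/-- Whether `prev.length` is the code of a formula, where `prev` tells this of all smaller
numbers. The sizes `x` are the numbers of agents, propositions and resources. -/
def formulaStep (x : ℕ × ℕ × ℕ) (prev : List Bool) : Bool :=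
  cond (prev.length.unpair.1 == 0) (Nat.blt prev.length.unpair.2 x.2.1) <|
  cond (prev.length.unpair.1 == 1) (prev.getD prev.length.unpair.2 false) <|
  cond (prev.length.unpair.1 == 2) (prev.getD prev.length.unpair.2.unpair.1 false &&
    prev.getD prev.length.unpair.2.unpair.2 false) <|
  cond (prev.length.unpair.1 == 3 || prev.length.unpair.1 == 4)
    (dataValid x.1 x.2.2 prev.length.unpair.2.unpair.1 &&
      prev.getD prev.length.unpair.2.unpair.2 false) <|
  cond (prev.length.unpair.1 == 5)
    ((dataValid x.1 x.2.2 prev.length.unpair.2.unpair.1 &&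
      prev.getD prev.length.unpair.2.unpair.2.unpair.1 false) &&
      prev.getD prev.length.unpair.2.unpair.2.unpair.2 false) false

open Classical in
/-- Whether `f` is the code of a formula, for the given numbers of agents, propositions and
resources. -/
noncomputable def formulaValid (x : ℕ × ℕ × ℕ) (f : ℕ) : Bool :=
  decide (∃ φ : Formula (Fin x.1) (Fin x.2.1) (Fin x.2.2), formulaCode φ = f)

theorem formulaValid_iff {x : ℕ × ℕ × ℕ} {f : ℕ} : formulaValid x f = true ↔
    ∃ φ : Formula (Fin x.1) (Fin x.2.1) (Fin x.2.2), formulaCode φ = f := by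
  simp [formulaValid]

/-- Subformulas have smaller codes than the formula, so validity of codes satisfies a
course-of-values recursion. -/
theorem formulaStep_eq (x : ℕ × ℕ × ℕ) (f : ℕ) :
    formulaStep x ((List.range f).map (formulaValid x)) = formulaValid x f := by
  have hget : ∀ i, i < f →
      ((List.range f).map (formulaValid x)).getD i false = formulaValid x i := by
    intro i hi
    simp [hi]
  have hlen : ((List.range f).map (formulaValid x)).length = f := by simp
  obtain ⟨t, b, rfl⟩ : ∃ t b, f = Nat.pair t b := ⟨_, _, (Nat.pair_unpair f).symm⟩
  have hlt : 0 < t → ∀ i, i ≤ b → i < Nat.pair t b := fun ht i hi => hi.trans_lt (lt_natPair ht b)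
  have h1 : b.unpair.1 ≤ b := Nat.unpair_left_le b
  have h2 : b.unpair.2 ≤ b := Nat.unpair_right_le b
  have h3 : b.unpair.2.unpair.1 ≤ b := (Nat.unpair_left_le _).trans h2
  have h4 : b.unpair.2.unpair.2 ≤ b := (Nat.unpair_right_le _).trans h2
  rw [formulaStep, hlen, Nat.unpair_pair]
  dsimp only
  rw [Bool.eq_iff_iff, formulaValid_iff]
  constructor
  · intro h
    simp only [Bool.cond_eq_ite, beq_iff_eq, Bool.or_eq_true] at h
    split_ifs at h with t0 t1 t2 t3 t5
    · rw [Nat.blt_eq] at h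
      exact ⟨.prop ⟨b, h⟩, by rw [t0]; rfl⟩
    · rw [hget _ (hlt (by omega) _ le_rfl), formulaValid_iff] at h
      obtain ⟨φ, hφ⟩ := h
      exact ⟨.neg φ, by rw [t1, ← hφ]; rfl⟩
    · rw [hget _ (hlt (by omega) _ h1), hget _ (hlt (by omega) _ h2), Bool.and_eq_true,
        formulaValid_iff, formulaValid_iff] at h
      obtain ⟨⟨φ, hφ⟩, ψ, hψ⟩ := h
      exact ⟨.and φ ψ, by rw [t2, formulaCode, hφ, hψ, Nat.pair_unpair]⟩
    · rw [hget _ (hlt (by omega) _ h2), Bool.and_eq_true, formulaValid_iff, dataValid_iff] at h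
      obtain ⟨⟨A, η, hA, hd⟩, φ, hφ⟩ := h
      rcases t3 with t3 | t3
      · exact ⟨.next A hA η φ, by rw [t3, formulaCode, hφ, ← hd, Nat.pair_unpair]⟩
      · exact ⟨.always A hA η φ, by rw [t3, formulaCode, hφ, ← hd, Nat.pair_unpair]⟩
    · rw [hget _ (hlt (by omega) _ h3), hget _ (hlt (by omega) _ h4), Bool.and_eq_true,
        Bool.and_eq_true, formulaValid_iff, formulaValid_iff, dataValid_iff] at h
      obtain ⟨⟨⟨A, η, hA, hd⟩, φ, hφ⟩, ψ, hψ⟩ := h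
      exact ⟨.until A hA η φ ψ, by
        rw [t5, formulaCode, hφ, hψ, ← hd, Nat.pair_unpair, Nat.pair_unpair]⟩
  · have hv : ∀ φ : Formula (Fin x.1) (Fin x.2.1) (Fin x.2.2),
        formulaValid x (formulaCode φ) = true := fun φ => formulaValid_iff.mpr ⟨φ, rfl⟩
    have hdv : ∀ (A : Finset (Fin x.1)) (_ : A.Nonempty) (η : Endowment (Fin x.1) (Fin x.2.2)),
        dataValid x.1 x.2.2 (Encodable.encode (bits A, endowmentCode η)) = true :=
      fun A hA η => dataValid_iff.mpr ⟨A, η, hA, rfl⟩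
    rintro ⟨φ, hφ⟩
    cases φ <;> rw [formulaCode, Nat.pair_eq_pair] at hφ <;> obtain ⟨rfl, rfl⟩ := hφ
    · simp
    · rw [hget _ (hlt (by omega) _ le_rfl), hv]
      rfl
    · rw [hget _ (hlt (by omega) _ h1), hget _ (hlt (by omega) _ h2), Nat.unpair_pair, hv, hv]
      rfl
    · rw [hget _ (hlt (by omega) _ h2), Nat.unpair_pair, hv, hdv _ ‹_›]
      rfl
    · rw [hget _ (hlt (by omega) _ h2), Nat.unpair_pair, hv, hdv _ ‹_›]
      rfl
    · rw [hget _ (hlt (by omega) _ h3), hget _ (hlt (by omega) _ h4), Nat.unpair_pair,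
        Nat.unpair_pair, hv, hv, hdv _ ‹_›]
      rfl

theorem primrec_dataValid {α : Type*} [Primcodable α] {f g h : α → ℕ} (hf : Primrec f)
    (hg : Primrec g) (hh : Primrec h) : Primrec fun x => dataValid (f x) (g x) (h x) := by
  unfold dataValid
  fun_prop

attribute [local fun_prop] primrec_dataValid

theorem primrec_formulaStep {α : Type*} [Primcodable α] {f : α → ℕ × ℕ × ℕ} {g : α → List Bool}
    (hf : Primrec f) (hg : Primrec g) : Primrec fun x => formulaStep (f x) (g x) := by
  unfold formulaStep
  fun_prop

theorem primrec_formulaValid {α : Type*} [Primcodable α] {f : α → ℕ × ℕ × ℕ} {g : α → ℕ}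
    (hf : Primrec f) (hg : Primrec g) : Primrec fun x => formulaValid (f x) (g x) := by
  have : Primrec₂ formulaValid := Primrec.nat_strong_rec formulaValid
    (g := fun x prev => some (formulaStep x prev))
    (Primrec.option_some.comp (primrec_formulaStep Primrec.fst Primrec.snd))
    fun x f => congrArg some (formulaStep_eq x f)
  exact this.comp hf hg

attribute [local fun_prop] primrec_formulaValid

namespace Code

/-- Whether `c` is the code of an input. -/
noncomputable def valid (c : Code) : Bool :=
  ((Nat.blt 0 c.1.1 && (Nat.blt 0 c.1.2.2.2.1 && Nat.blt 0 c.1.2.2.2.2)) &&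
  (c.2.1.length == c.1.2.1 && c.2.1.all fun l => l.length == c.1.2.2.1)) &&
  ((c.2.2.1.length == c.1.1 && c.2.2.1.all fun l =>
    l.length == c.1.2.1 && l.all fun l => l.length == c.1.2.2.2.1) &&
  ((c.2.2.2.1.length == c.1.2.1 && c.2.2.2.1.all fun l =>
    l.length == c.1.2.2.2.1 ^ c.1.1 && l.all fun q => Nat.blt q c.1.2.1) &&
  ((c.2.2.2.2.1.length == c.1.2.2.2.1 && c.2.2.2.2.1.all fun l =>
    l.length == c.1.2.2.2.2 && l.all fun e => !(e.1 && e.2 == 0)) &&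
  (Nat.blt c.2.2.2.2.2.1 c.1.2.1 &&
    formulaValid (c.1.1, c.1.2.2.1, c.1.2.2.2.2) c.2.2.2.2.2.2))))

theorem primrec_valid : Primrec valid := by
  unfold valid
  fun_prop

theorem valid_code (I : Input) : valid I.code = true := by
  simp only [valid, Bool.and_eq_true, beq_iff_eq, Nat.blt_eq, List.all_eq_true]
  refine ⟨⟨⟨I.agents_pos, I.actions_pos, I.resources_pos⟩, by simp [Input.code], ?_⟩,
    ⟨by simp [Input.code], ?_⟩, ⟨by simp [Input.code], ?_⟩, ⟨by simp [Input.code], ?_⟩, ?_,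
    formulaValid_iff.mpr ⟨I.formula, rfl⟩⟩
  · intro l hl
    obtain ⟨q, rfl⟩ := (List.mem_ofFn' _ _).mp hl
    simp [bits, Input.code]
  · intro l hl
    obtain ⟨a, rfl⟩ := (List.mem_ofFn' _ _).mp hl
    refine ⟨by simp [Input.code], fun l hl => ?_⟩
    obtain ⟨q, rfl⟩ := (List.mem_ofFn' _ _).mp hl
    simp [bits, Input.code]
  · intro l hl
    obtain ⟨q, rfl⟩ := (List.mem_ofFn' _ _).mp hl
    refine ⟨by simp [Input.code], fun s hs => ?_⟩
    obtain ⟨i, rfl⟩ := (List.mem_ofFn' _ _).mp hs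
    exact Fin.is_lt _
  · intro l hl
    obtain ⟨α, rfl⟩ := (List.mem_ofFn' _ _).mp hl
    refine ⟨by simp [Input.code], fun e he => ?_⟩
    obtain ⟨r, rfl⟩ := (List.mem_ofFn' _ _).mp he
    simp only [Bool.not_eq_true', Bool.and_eq_false_iff, decide_eq_false_iff_not,
      beq_eq_false_iff_ne]
    omega
  · exact I.state.is_lt

theorem exists_input {c : Code} (h : valid c = true) : ∃ I : Input, I.code = c := by
  obtain ⟨⟨n, s, p, m, k⟩, v, a, o, t, q, f⟩ := c
  simp only [valid, Bool.and_eq_true, beq_iff_eq, Nat.blt_eq, List.all_eq_true] at h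
  obtain ⟨⟨⟨hn, hm, hk⟩, hv1, hv2⟩, ⟨ha1, ha2⟩, ⟨ho1, ho2⟩, ⟨ht1, ht2⟩, hq, hf⟩ := h
  obtain ⟨φ, hφ⟩ := formulaValid_iff.mp hf
  have ho : ∀ (q : Fin s) (i : Fin (m ^ n)), (o.getD q []).getD i 0 < s := fun q i => by
    have h := ho2 _ (mem_of_getD [] (q.2.trans_eq ho1.symm))
    exact h.2 _ (mem_of_getD 0 (i.2.trans_eq h.1.symm))
  let M : RBM (Fin n) (Fin s) (Fin p) (Fin m) (Fin k) :=
    { val := fun q => Finset.univ.filter fun x => (v.getD q []).getD x false = true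
      avail := fun b q => Finset.univ.filter fun α =>
        ((a.getD b []).getD q []).getD α false = true
      step := fun q σ => ⟨(o.getD q []).getD (finFunctionFinEquiv σ : Fin (m ^ n)) 0, ho q _⟩
      t := fun α r => cond ((t.getD α []).getD r (false, 0)).1
        (-(((t.getD α []).getD r (false, 0)).2 : ℤ)) (((t.getD α []).getD r (false, 0)).2 : ℤ) }
  refine ⟨⟨n, s, p, m, k, hn, hm, hk, M, ⟨q, hq⟩, φ⟩, ?_⟩
  have e1 : (List.ofFn fun q => bits (M.val q)) = v :=
    ofFn_eq [] hv1 fun q => bits_filter (hv2 _ (mem_of_getD [] (q.2.trans_eq hv1.symm)))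
  have e2 : (List.ofFn fun b => List.ofFn fun q => bits (M.avail b q)) = a := by
    refine ofFn_eq [] ha1 fun b => ?_
    have h := ha2 _ (mem_of_getD [] (b.2.trans_eq ha1.symm))
    exact ofFn_eq [] h.1 fun q => bits_filter (h.2 _ (mem_of_getD [] (q.2.trans_eq h.1.symm)))
  have e3 : (List.ofFn fun q => List.ofFn fun i : Fin (m ^ n) =>
      (M.step q (finFunctionFinEquiv.symm i) : ℕ)) = o := by
    refine ofFn_eq [] ho1 fun q => ?_
    have h := ho2 _ (mem_of_getD [] (q.2.trans_eq ho1.symm))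
    refine ofFn_eq 0 h.1 fun i => ?_
    simp only [M, Equiv.apply_symm_apply]
  have e4 : (List.ofFn fun α => List.ofFn fun r =>
      (decide (M.t α r < 0), (M.t α r).natAbs)) = t := by
    refine ofFn_eq [] ht1 fun α => ?_
    have h := ht2 _ (mem_of_getD [] (α.2.trans_eq ht1.symm))
    refine ofFn_eq (false, 0) h.1 fun r => ?_
    have h' := h.2 _ (mem_of_getD (false, 0) (r.2.trans_eq h.1.symm))
    exact signed_eq h'
  simp only [Input.code, e1, e2, e3, e4]
  rw [hφ]

end Code

/-! ### Decidability -/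

/-- Unbounded search: the projection of a primitive recursive relation is recursively
enumerable. -/
theorem rePred_exists {α β : Type*} [Primcodable α] [Primcodable β] {p : α → β → Bool}
    (hp : Primrec₂ p) : REPred fun a => ∃ b, p a b = true := by
  have h : Computable₂ fun (a : α) (i : ℕ) =>
      (Encodable.decode i : Option β).bind fun b => cond (p a b) (some ()) none :=
    Primrec.to_comp (Primrec.option_bind (Primrec.decode.comp Primrec.snd)
      (Primrec.cond (hp.comp (Primrec.fst.comp Primrec.fst) Primrec.snd)
        (Primrec.const _) (Primrec.const _)))
  refine (Partrec.rfindOpt h).dom_re.of_eq fun a => Nat.rfindOpt_dom.trans ?_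
  constructor
  · rintro ⟨i, u, hi⟩
    obtain ⟨b, -, hb⟩ := Option.bind_eq_some_iff.mp hi
    refine ⟨b, ?_⟩
    cases h : p a b
    · simp [h] at hb
    · rfl
  · rintro ⟨b, hb⟩
    exact ⟨Encodable.encode b, (), by simp [hb]⟩

theorem modelChecking_iff (rule : ShareRule) (c : Code) : ModelChecking rule c ↔
    ∃ L, (Code.valid c && (Code.check rule.isLax c L &&
      Code.claims c L c.2.2.2.2.2.2 c.2.2.2.2.2.1 true)) = true := by
  classical
  simp only [Bool.and_eq_true]
  constructor
  · rintro ⟨I, rfl, hI⟩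
    obtain ⟨L, h1, h2⟩ := Code.exists_check_claims I (rule := rule) I.formula
    refine ⟨L, Code.valid_code I, h1, ?_⟩
    have := h2 I.state
    rwa [decide_eq_true hI] at this
  · rintro ⟨L, h0, h1, h2⟩
    obtain ⟨I, rfl⟩ := Code.exists_input h0
    exact ⟨I, rfl, (Code.claims_sound I h1 I.formula I.state true h2).mpr rfl⟩

theorem not_modelChecking_iff (rule : ShareRule) (c : Code) : ¬ ModelChecking rule c ↔
    ∃ L, (!Code.valid c || (Code.check rule.isLax c L &&
      Code.claims c L c.2.2.2.2.2.2 c.2.2.2.2.2.1 false)) = true := by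
  classical
  simp only [Bool.or_eq_true, Bool.and_eq_true, Bool.not_eq_true']
  constructor
  · intro h
    cases h0 : Code.valid c
    · exact ⟨[], Or.inl rfl⟩
    · obtain ⟨I, rfl⟩ := Code.exists_input h0
      obtain ⟨L, h1, h2⟩ := Code.exists_check_claims I (rule := rule) I.formula
      refine ⟨L, Or.inr ⟨h1, ?_⟩⟩
      have := h2 I.state
      rwa [decide_eq_false fun hI => h ⟨I, rfl, hI⟩] at this
  · rintro ⟨L, h⟩ ⟨I, rfl, hI⟩
    rcases h with h | ⟨h1, h2⟩
    · rw [Code.valid_code I] at h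
      exact absurd h (by simp)
    · exact absurd ((Code.claims_sound I h1 I.formula I.state false h2).mp hI) (by simp)

theorem primrec_modelChecking_yes (rule : ShareRule) : Primrec₂ fun (c : Code) L =>
    Code.valid c && (Code.check rule.isLax c L &&
      Code.claims c L c.2.2.2.2.2.2 c.2.2.2.2.2.1 true) := by
  have := Code.primrec_valid.comp (Primrec.fst (α := Code) (β := List Code.Entry))
  unfold Primrec₂
  fun_prop

theorem primrec_modelChecking_no (rule : ShareRule) : Primrec₂ fun (c : Code) L =>
    !Code.valid c || (Code.check rule.isLax c L &&
      Code.claims c L c.2.2.2.2.2.2 c.2.2.2.2.2.1 false) := by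
  have := Code.primrec_valid.comp (Primrec.fst (α := Code) (β := List Code.Entry))
  unfold Primrec₂
  fun_prop

end Validity

end RAL

theorem mainTheorem2 (rule : RAL.ShareRule) : ComputablePred (RAL.ModelChecking rule) := by
  classical
  refine ComputablePred.computable_iff_re_compl_re'.mpr ⟨?_, ?_⟩
  · exact (RAL.rePred_exists (RAL.primrec_modelChecking_yes rule)).of_eq fun c =>
      (RAL.modelChecking_iff rule c).symm
  · exact (RAL.rePred_exists (RAL.primrec_modelChecking_no rule)).of_eq fun c =>
      (RAL.not_modelChecking_iff rule c).symm
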